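/- Let $K$ be an algebraically closed field of characteristic zero (for example $K=\mathbb{C}$), let $N\ge 0$ and $1\le r\le N+1$ be integers, and let $\mathbb{P}=\mathbb{P}(K^{(N+1)\times(N+1)})\cong\mathbb{P}^{N(N+2)}$ be the projective space of $(N+1)\times(N+1)$ matrices over $K$. Let $X_r\subset\mathbb{P}$ be the determinantal variety of matrices of rank at most $r$, and let $S_r\subset X_r$ and $A_r\subset X_r$ be the subvarieties of symmetric and of skew-symmetric matrices of rank at most $r$. For an irreducible projective variety $X\subset\mathbb{P}$ and a closed subset $Z\subset X$, the conormal variety $W_{X,Z}\subset\mathbb{P}\times\mathbb{P}^\vee$ of $X$ relative to $Z$ is the Zariski closure of the set of pairs $(x,H)$ such that $x\in Z$ is a smooth point of $X$ and $H$ is a hyperplane that contains the projective tangent space $T_xX$; the dual variety of $X$ relative to $Z$ is $X_Z^\vee=\mathrm{pr}_2(W_{X,Z})\subset\mathbb{P}^\vee$. The spaces $\mathbb{P}^\vee$ and $\mathbb{P}$ are identified by letting a matrix $B\neq 0$ correspond to the hyperplane $\{A : \sum_{i,j}b_{ij}a_{ij}=0\}$. For $p\ge 0$, the compound matrix $C_p(B)$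 is the matrix of all $p\times p$ minors $\det B[I;J]$, with rows and columns indexed by the $p$-element subsets $I,J$ of $\{1,\dots,N+1\}$ in the same order. Then $$(X_r)_{S_r}^\vee=\overline{\{B\in\mathbb{P} : \operatorname{rank}(B)=N+1-r \text{ and } C_{N+1-r}(B)\text{ is symmetric}\}},$$ where the bar is the Zariski closure in $\mathbb{P}$. Furthermore, $(X_r)_{A_r}^\vee=(X_r)_{S_r}^\vee$ if $r$ is even, and $(X_r)_{A_r}^\vee=\emptyset$ if $r$ is odd. (For $r=N+1$ all these sets are empty.) -/

import Mathlib

open scoped LinearAlgebra.Projectivization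

noncomputable section

namespace RelDual

variable {K : Type*} [Field K] {ι κ : Type*}

/-! ### Projective varieties as point sets

`ℙ K (ι → K)` is the projective space with homogeneous coordinates indexed by `ι`. -/

/-- The Zariski closure of a set of points of projective space: the common zeros of all homogeneous
polynomials that vanish on the set. -/
def projClosure (S : Set (ℙ K (ι → K))) : Set (ℙ K (ι → K)) :=
  {p | ∀ (f : MvPolynomial ι K) (d : ℕ), f.IsHomogeneous d →
    (∀ q ∈ S, MvPolynomial.eval q.rep f = 0) → MvPolynomial.eval p.rep f = 0}

/-- A polynomial in two groups of variables is bihomogeneous of bidegree `(a, b)`. -/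
def IsBihomogeneous (f : MvPolynomial (ι ⊕ κ) K) (a b : ℕ) : Prop :=
  MvPolynomial.IsWeightedHomogeneous
    (Sum.elim (fun _ => ((1, 0) : ℕ × ℕ)) (fun _ => ((0, 1) : ℕ × ℕ))) f (a, b)

/-- The Zariski closure of a set of points of a product of two projective spaces: the common zeros
of all bihomogeneous polynomials that vanish on the set. -/
def biprojClosure (S : Set (ℙ K (ι → K) × ℙ K (κ → K))) : Set (ℙ K (ι → K) × ℙ K (κ → K)) :=
  {p | ∀ (f : MvPolynomial (ι ⊕ κ) K) (a b : ℕ), IsBihomogeneous f a b →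
    (∀ q ∈ S, MvPolynomial.eval (Sum.elim q.1.rep q.2.rep) f = 0) →
      MvPolynomial.eval (Sum.elim p.1.rep p.2.rep) f = 0}

/-- The nonzero vectors of the affine cone over a set of points of projective space. -/
def coneOver (X : Set (ℙ K (ι → K))) : Set (ι → K) :=
  {v | ∃ h : v ≠ 0, Projectivization.mk K v h ∈ X}

/-- The ideal `I(X)` of all polynomials that vanish on the affine cone over `X`. -/
def idealOf (X : Set (ℙ K (ι → K))) : Ideal (MvPolynomial ι K) :=
  MvPolynomial.vanishingIdeal K (coneOver X)

/-- The (embedded) Zariski tangent space of `X` at `x`, as a linear subspace of `K^ι`: the vectors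
`w` with `∑ i, (∂f/∂x_i)(x) w_i = 0` for all `f ∈ I(X)`.  At a smooth point, its projectivization
is the projective tangent space `T_x X`. -/
def tangentSpace [Fintype ι] (X : Set (ℙ K (ι → K))) (x : ℙ K (ι → K)) :
    Submodule K (ι → K) where
  carrier := {w | ∀ f ∈ idealOf X,
    ∑ i, MvPolynomial.eval x.rep (MvPolynomial.pderiv i f) * w i = 0}
  zero_mem' := by
    intro f _
    simp
  add_mem' := by
    intro v w hv hw f hf
    simp only [Pi.add_apply, mul_add, Finset.sum_add_distrib, hv f hf, hw f hf, add_zero]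
  smul_mem' := by
    intro c w hw f hf
    simp only [Pi.smul_apply, smul_eq_mul, mul_left_comm _ c, ← Finset.mul_sum, hw f hf, mul_zero]

/-- The smooth points of an irreducible projective variety `X`: the points where the dimension
of the (linear) tangent space is the dimension `dim X + 1` of the affine cone over `X`, which is the
transcendence degree of the homogeneous coordinate ring of `X`. -/
def smoothLocus [Fintype ι] (X : Set (ℙ K (ι → K))) : Set (ℙ K (ι → K)) :=
  {x | x ∈ X ∧
    (Module.finrank K (tangentSpace X x) : Cardinal) = Algebra.trdeg K (MvPolynomial ι K ⧸ idealOf X)}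

/-! ### Relative duality

A point `H` of the dual projective space is given by its dual homogeneous coordinates: `H`
is the hyperplane `∑ i, H_i x_i = 0`. -/

/-- The hyperplane `H` is tangent to `X` at the smooth point `x`, i.e. contains `T_x X`. -/
def IsTangentAt [Fintype ι] (X : Set (ℙ K (ι → K))) (x H : ℙ K (ι → K)) : Prop :=
  x ∈ smoothLocus X ∧ ∀ w ∈ tangentSpace X x, ∑ i, H.rep i * w i = 0

/-- The incidence variety of pairs `(x, H)` with `x ∈ X_sm ∩ Z` and `H` tangent to `X` at `x`. -/
def relConormalOpen [Fintype ι] (X Z : Set (ℙ K (ι → K))) :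
    Set (ℙ K (ι → K) × ℙ K (ι → K)) :=
  {p | p.1 ∈ Z ∧ IsTangentAt X p.1 p.2}

/-- The conormal variety of `X` relative to `Z`. -/
def relConormal [Fintype ι] (X Z : Set (ℙ K (ι → K))) :
    Set (ℙ K (ι → K) × ℙ K (ι → K)) :=
  biprojClosure (relConormalOpen X Z)

/-- The dual variety of `X` relative to `Z`. -/
def relDualVariety [Fintype ι] (X Z : Set (ℙ K (ι → K))) : Set (ℙ K (ι → K)) :=
  Prod.snd '' relConormal X Z

/-! ### Determinantal varieties -/

/-- The projective space of `(N+1) × (N+1)` matrices, homogeneous coordinates being the entries. -/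
abbrev MatProj (K : Type*) [Field K] (N : ℕ) : Type _ :=
  ℙ K (Fin (N + 1) × Fin (N + 1) → K)

/-- A matrix that represents a point of the projective space of matrices. -/
def toMat {N : ℕ} (p : MatProj K N) : Matrix (Fin (N + 1)) (Fin (N + 1)) K :=
  Matrix.of fun i j => p.rep (i, j)

/-- Matrices of rank at most `r`. -/
def detVar (K : Type*) [Field K] (N r : ℕ) : Set (MatProj K N) :=
  {p | (toMat p).rank ≤ r}

/-- Symmetric matrices of rank at most `r`. -/
def symDetVar (K : Type*) [Field K] (N r : ℕ) : Set (MatProj K N) :=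
  {p | p ∈ detVar K N r ∧ (toMat p).transpose = toMat p}

/-- Skew-symmetric matrices of rank at most `r`. -/
def skewDetVar (K : Type*) [Field K] (N r : ℕ) : Set (MatProj K N) :=
  {p | p ∈ detVar K N r ∧ (toMat p).transpose = -toMat p}

/-- The `r`-th compound matrix: rows and columns are indexed by the `r`-element sets of row and
column indices, and the entry at `(I, J)` is the minor `det A[I; J]`. -/
def compound {m n : ℕ} (r : ℕ) (A : Matrix (Fin m) (Fin n) K) :
    Matrix {I : Finset (Fin m) // I.card = r} {J : Finset (Fin n) // J.card = r} K :=
  Matrix.of fun I J =>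
    (A.submatrix (I.1.orderEmbOfFin I.2) (J.1.orderEmbOfFin J.2)).det

end RelDual

end

/-! Put `s = N + 1 - r`. Under the pairing `∑ bᵢⱼ aᵢⱼ = tr(BᵀA)`, a hyperplane `B` is tangent to
`X_r` at `A` iff `A` has rank exactly `r` and `Aᵀ B = 0 = B Aᵀ` (`isTangentAt_detVar_iff`). If `Aᵀ =
ε A` with `ε = ±1`, this says `A B = 0 = B A`: the columns of `B` and of `Bᵀ` lie in the
`s`-dimensional space `ker A`, so `B = L S Lᵀ` with the columns of `L` a basis of `ker A`
(`IsSupported`). Conversely, for such a `B` choose `r` independent vectors killed by `B` and `Bᵀ`,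
as the columns of `W`, and take `A = W S₀ Wᵀ` with `S₀` nonsingular and `S₀ᵀ = ε S₀`. Here `S₀ = 1`
serves the symmetric case and the standard symplectic matrix the skew case with `r` even. For `r`
odd no skew matrix has rank `r`, so the conormal set is empty.

The matrices `L S Lᵀ` are those for which `B` stacked on `Bᵀ` has rank at most `s`. This is a closed
condition, so passing to the closure of the conormal set adds nothing in the second factor
(`relDualVariety_eq_supportedSet`).

If `B = P Q` has rank `s`, then `C_s(B)` is the product of the column of maximal minors of `P` with
the row of those of `Q`. It is symmetric iff these Plücker vectors are proportional, i.e. iff `B`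
and `Bᵀ` have the same column space. Replacing `S` by `S + t` shows that the rank `s` matrices are
dense among all `L S Lᵀ` (`projClosure_compound_isSymm`).

The tangent spaces require `I(X_r)`. It is the kernel of the map of polynomial rings dual to `(M, N)
↦ M N`, so its elements vanish on products over every `K`-algebra, in particular over the dual
numbers. Factorizations there produce tangent vectors and bordered minors bound the tangent space.
The same minors give the dimension of `X_r`, so rank `r` points are smooth. -/

namespace RelDual

open Matrix

/-! ### Linear algebra: factorizations, matrices `L S Lᵀ`, compound matrices, skew forms. -/

section MatrixLemmas

variable {K : Type*} [Field K] {m ρ τ κ : Type*} [Fintype m] [DecidableEq m]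
  [Fintype ρ] [DecidableEq ρ] [Fintype τ] [DecidableEq τ] [Fintype κ] [DecidableEq κ]

/-- A full-rank factorization of a square matrix. -/
theorem exists_full_rank_factorization (A : Matrix m m K) {k : ℕ} (hk : A.rank = k) :
    ∃ (M : Matrix m (Fin k) K) (M' : Matrix (Fin k) m K)
      (N : Matrix (Fin k) m K) (N' : Matrix m (Fin k) K),
      A = M * N ∧ M' * M = 1 ∧ N * N' = 1 := by
  subst hk
  obtain ⟨V, U, e, hV, hU, h⟩ := A.exists_rank_normal_form
  rw [isUnit_iff_isUnit_det] at hV hU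
  set E : Matrix m (Fin A.rank) K := (fromRows 1 0).submatrix e id
  set F : Matrix (Fin A.rank) m K := (fromCols 1 0).submatrix id e
  have hEF : E * F = (fromBlocks 1 0 0 0).submatrix e e := by
    rw [show E * F = ((fromRows 1 0 : Matrix (_ ⊕ _) (Fin A.rank) K) *
      (fromCols 1 0 : Matrix (Fin A.rank) (_ ⊕ _) K)).submatrix e e from rfl,
      fromRows_mul_fromCols]
    simp
  have hFE : F * E = 1 := by
    rw [submatrix_mul_equiv (fromCols 1 0) (fromRows 1 0) id e id,
      fromCols_mul_fromRows]
    simp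
  refine ⟨V⁻¹ * E, F * V, F * U⁻¹, U * E, ?_, ?_, ?_⟩
  · calc A = V⁻¹ * (V * A * U) * U⁻¹ := by
          simp only [Matrix.mul_assoc]
          rw [mul_nonsing_inv U hU, Matrix.mul_one, ← Matrix.mul_assoc, nonsing_inv_mul V hV,
            Matrix.one_mul]
      _ = V⁻¹ * E * (F * U⁻¹) := by rw [h, ← hEF]; simp only [Matrix.mul_assoc]
  · rw [Matrix.mul_assoc, ← Matrix.mul_assoc V, mul_nonsing_inv V hV, Matrix.one_mul, hFE]
  · rw [Matrix.mul_assoc, ← Matrix.mul_assoc U⁻¹, nonsing_inv_mul U hU, Matrix.one_mul, hFE]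

theorem exists_left_inverse_of_injective (f : (τ → K) →ₗ[K] (m → K))
    (hf : Function.Injective f) :
    ∃ L' : Matrix τ m K, L' * LinearMap.toMatrix' f = 1 := by
  obtain ⟨g, hg⟩ := f.exists_leftInverse_of_injective (LinearMap.ker_eq_bot.mpr hf)
  exact ⟨LinearMap.toMatrix' g, by rw [← LinearMap.toMatrix'_comp, hg, LinearMap.toMatrix'_id]⟩

omit [DecidableEq m] [DecidableEq ρ] in
/-- A matrix with a left inverse has full rank. -/
theorem rank_eq_card_of_left_inverse {W : Matrix m ρ K} {W' : Matrix ρ m K} [DecidableEq ρ]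
    (h : W' * W = 1) : W.rank = Fintype.card ρ := by
  refine le_antisymm W.rank_le_card_width ?_
  rw [← rank_one (R := K) (n := ρ), ← h]
  exact rank_mul_le_right _ _

/-- The orthogonal complement of the column space of a matrix with a left inverse. -/
theorem exists_complement (hc : Fintype.card m = Fintype.card ρ + Fintype.card τ)
    {W : Matrix m ρ K} {W' : Matrix ρ m K} (hW : W' * W = 1) :
    ∃ (L : Matrix m τ K) (L' : Matrix τ m K), L' * L = 1 ∧ Wᵀ * L = 0 ∧
      ∀ v : Matrix m m K, Wᵀ * v = 0 → L * (L' * v) = v := by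
  have hr : Wᵀ.rank = Fintype.card ρ := by
    rw [rank_transpose, rank_eq_card_of_left_inverse hW]
  have hk : Module.finrank K (LinearMap.ker Wᵀ.mulVecLin) = Fintype.card τ := by
    have := LinearMap.finrank_range_add_finrank_ker Wᵀ.mulVecLin
    rw [Module.finrank_fintype_fun_eq_card] at this
    rw [Matrix.rank] at hr
    omega
  let b : Module.Basis τ K (LinearMap.ker Wᵀ.mulVecLin) :=
    (Module.finBasisOfFinrankEq K _ hk).reindex (Fintype.equivFin τ).symm
  let f : (τ → K) →ₗ[K] (m → K) :=
    (LinearMap.ker Wᵀ.mulVecLin).subtype ∘ₗ b.equivFun.symm.toLinearMap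
  have hf : Function.Injective f :=
    Subtype.val_injective.comp b.equivFun.symm.injective
  obtain ⟨L', hL'⟩ := exists_left_inverse_of_injective f hf
  have hmem : ∀ c, Wᵀ *ᵥ (f c) = 0 := fun c => (b.equivFun.symm c).2
  refine ⟨LinearMap.toMatrix' f, L', hL', ?_, fun v hv => ?_⟩
  · refine Matrix.ext_of_mulVec_single fun i => ?_
    rw [← mulVec_mulVec, LinearMap.toMatrix'_mulVec, hmem, zero_mulVec]
  · refine Matrix.ext_of_mulVec_single fun i => ?_
    have h0 : v *ᵥ Pi.single i 1 ∈ LinearMap.ker Wᵀ.mulVecLin := by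
      rw [LinearMap.mem_ker, mulVecLin_apply, mulVec_mulVec, hv, zero_mulVec]
    obtain ⟨c, hcc⟩ : ∃ c, f c = v *ᵥ Pi.single i 1 :=
      ⟨b.equivFun ⟨_, h0⟩, by simp [f]⟩
    rw [← mulVec_mulVec, ← mulVec_mulVec, ← hcc, ← LinearMap.toMatrix'_mulVec f,
      mulVec_mulVec _ L', hL', one_mulVec]

/-- `B` is of the form `L S Lᵀ` with `L` a matrix with independent columns indexed by `τ`: its row
and column spaces lie in a common subspace of dimension `card τ`. -/
def IsSupported (τ : Type*) [Fintype τ] [DecidableEq τ] (B : Matrix m m K) : Prop :=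
  ∃ (L : Matrix m τ K) (L' : Matrix τ m K) (S : Matrix τ τ K), L' * L = 1 ∧ B = L * S * Lᵀ

/-- The product `L * L'` fixes every matrix whose columns are orthogonal to those of `W`, hence
fixes both `B` and `Bᵀ`. Applying it on the two sides of `B` gives the middle factor `L' * B * L'ᵀ`.
-/
theorem isSupported_of_mul_eq_zero (hc : Fintype.card m = Fintype.card ρ + Fintype.card τ)
    {B : Matrix m m K} {W : Matrix m ρ K} {W' : Matrix ρ m K} (hW : W' * W = 1)
    (h1 : B * W = 0) (h2 : Bᵀ * W = 0) : IsSupported τ B := by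
  obtain ⟨L, L', hL, -, h⟩ := exists_complement (τ := τ) hc hW
  have e1 := h B (by rw [← transpose_transpose B, ← transpose_mul, h2, transpose_zero])
  have e2 := congrArg transpose (h Bᵀ (by rw [← transpose_mul, h1, transpose_zero]))
  rw [transpose_mul, transpose_mul, transpose_transpose] at e2
  refine ⟨L, L', L' * B * L'ᵀ, hL, ?_⟩
  rw [← Matrix.mul_assoc, ← Matrix.mul_assoc, Matrix.mul_assoc L, e1, e2]

theorem IsSupported.exists_mul_eq_zero (hc : Fintype.card m = Fintype.card ρ + Fintype.card τ)
    {B : Matrix m m K} (h : IsSupported τ B) :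
    ∃ (W : Matrix m ρ K) (W' : Matrix ρ m K), W' * W = 1 ∧ B * W = 0 ∧ Bᵀ * W = 0 := by
  obtain ⟨L, L', S, hL, rfl⟩ := h
  obtain ⟨W, W', hW, h0, -⟩ := exists_complement (τ := ρ) (hc.trans (add_comm _ _)) hL
  refine ⟨W, W', hW, ?_, ?_⟩
  · rw [Matrix.mul_assoc, h0, Matrix.mul_zero]
  · rw [transpose_mul, transpose_mul, transpose_transpose, ← Matrix.mul_assoc, Matrix.mul_assoc,
      h0, Matrix.mul_zero]

/-- Large rank is thus detected by a nonzero `det (P * C * Q)`, so that a rank bound becomes a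
family of polynomial equations without a choice of minors. `Q` selects preimages of independent
vectors of the range and `P` is a left inverse of the resulting matrix. -/
theorem exists_mul_mul_eq_one {l : Type*} [Fintype l] [DecidableEq l] (C : Matrix l m K)
    (h : Fintype.card κ ≤ C.rank) :
    ∃ (P : Matrix κ l K) (Q : Matrix m κ K), P * C * Q = 1 := by
  let b := Module.finBasis K (LinearMap.range C.mulVecLin)
  obtain ⟨σ⟩ : Nonempty (κ ↪ Fin C.rank) :=
    Function.Embedding.nonempty_of_card_le (by simpa using h)
  have hb : LinearIndependent K (fun k => ((b (σ k) : LinearMap.range C.mulVecLin) : l → K)) :=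
    ((b.linearIndependent.comp σ σ.injective).map'
      (LinearMap.range C.mulVecLin).subtype (Submodule.ker_subtype _))
  choose q hq using fun k => (b (σ k)).2
  obtain ⟨P, hP⟩ := exists_left_inverse_of_injective
    (C.mulVecLin ∘ₗ (Matrix.of fun i k => q k i).mulVecLin) (by
      intro c d hcd
      have key : ∀ c : κ → K, C *ᵥ ((Matrix.of fun i k => q k i) *ᵥ c) =
          ∑ k, c k • ((b (σ k) : LinearMap.range C.mulVecLin) : l → K) := by
        intro c
        have : (Matrix.of fun i k => q k i) *ᵥ c = ∑ k, c k • q k := by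
          ext i
          simp [mulVec, dotProduct, mul_comm]
        rw [this, ← mulVecLin_apply, map_sum]
        exact Finset.sum_congr rfl fun k _ => by rw [map_smul, hq]
      simp only [LinearMap.comp_apply, mulVecLin_apply, key] at hcd
      have := Fintype.linearIndependent_iff.mp hb (fun k => c k - d k) (by
        simp only [sub_smul, Finset.sum_sub_distrib, hcd, sub_self])
      exact funext fun k => sub_eq_zero.mp (this k))
  refine ⟨P, Matrix.of fun i k => q k i, ?_⟩
  rw [LinearMap.toMatrix'_comp, ← toLin'_apply', ← toLin'_apply', LinearMap.toMatrix'_toLin',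
    LinearMap.toMatrix'_toLin'] at hP
  rw [Matrix.mul_assoc, hP]

omit [DecidableEq τ] in
theorem det_eq_zero_of_card_lt {P : Matrix κ τ K} {Q : Matrix τ κ K}
    (h : Fintype.card τ < Fintype.card κ) : (P * Q).det = 0 := by
  by_contra hd
  have h1 := rank_of_det_ne_zero hd
  have h2 := (rank_mul_le_left P Q).trans P.rank_le_card_width
  omega

/-- The matrices `L S Lᵀ` form a determinantal variety. -/
theorem isSupported_iff_det (ρ : Type*) [Fintype ρ] [DecidableEq ρ]
    (hc : Fintype.card m = Fintype.card ρ + Fintype.card τ)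
    (B : Matrix m m K) : IsSupported τ B ↔
      ∀ (P : Matrix (Option τ) (m ⊕ m) K) (Q : Matrix m (Option τ) K),
        (P * fromRows B Bᵀ * Q).det = 0 := by
  constructor
  · rintro ⟨L, L', S, hL, rfl⟩ P Q
    -- The stacked matrix factors through `K^τ`, whereas the determinant has size `Option τ`, one
    -- more than `τ`.
    have : fromRows (L * S * Lᵀ) (L * S * Lᵀ)ᵀ = fromRows (L * S) (L * Sᵀ) * Lᵀ := by
      rw [fromRows_mul]
      simp only [transpose_mul, transpose_transpose, Matrix.mul_assoc]
    rw [this, ← Matrix.mul_assoc, Matrix.mul_assoc]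
    exact det_eq_zero_of_card_lt (by simp)
  · intro h
    -- The kernel of the stacked matrix is the common kernel of `B` and `Bᵀ`; the rank bound leaves
    -- room in it for `card ρ` independent vectors.
    have hr : (fromRows B Bᵀ).rank ≤ Fintype.card τ := by
      by_contra hlt
      obtain ⟨P, Q, hPQ⟩ := exists_mul_mul_eq_one (κ := Option τ) (fromRows B Bᵀ) (by
        rw [Fintype.card_option]; omega)
      have := h P Q
      rw [hPQ, det_one] at this
      exact one_ne_zero this
    have hk : Fintype.card ρ ≤ Module.finrank K (LinearMap.ker (fromRows B Bᵀ).mulVecLin) := by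
      have := LinearMap.finrank_range_add_finrank_ker (fromRows B Bᵀ).mulVecLin
      rw [Module.finrank_fintype_fun_eq_card] at this
      rw [Matrix.rank] at hr
      omega
    let b := Module.finBasis K (LinearMap.ker (fromRows B Bᵀ).mulVecLin)
    obtain ⟨σ⟩ : Nonempty (ρ ↪ Fin (Module.finrank K
        (LinearMap.ker (fromRows B Bᵀ).mulVecLin))) :=
      Function.Embedding.nonempty_of_card_le (by simpa using hk)
    have hb : LinearIndependent K
        (fun k => ((b (σ k) : LinearMap.ker (fromRows B Bᵀ).mulVecLin) : m → K)) :=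
      ((b.linearIndependent.comp σ σ.injective).map'
        (LinearMap.ker (fromRows B Bᵀ).mulVecLin).subtype (Submodule.ker_subtype _))
    obtain ⟨W', hW'⟩ := exists_left_inverse_of_injective
      (Fintype.linearCombination K
        (fun k => ((b (σ k) : LinearMap.ker (fromRows B Bᵀ).mulVecLin) : m → K)))
      (linearIndependent_iff_injective_fintypeLinearCombination.mp hb)
    have h0 : fromRows B Bᵀ * LinearMap.toMatrix' (Fintype.linearCombination K
        (fun k => ((b (σ k) : LinearMap.ker (fromRows B Bᵀ).mulVecLin) : m → K))) = 0 := by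
      refine Matrix.ext_of_mulVec_single fun i => ?_
      rw [← mulVec_mulVec, LinearMap.toMatrix'_mulVec, zero_mulVec,
        Fintype.linearCombination_apply_single, one_smul]
      exact (b (σ i)).2
    rw [fromRows_mul, ← fromRows_zero, fromRows_ext_iff] at h0
    exact isSupported_of_mul_eq_zero hc hW' h0.1 h0.2

omit [DecidableEq m] in
/-- A matrix with a left inverse has a nonvanishing maximal minor. -/
theorem exists_det_submatrix_ne_zero {L : Matrix m τ K} {L' : Matrix τ m K} (h : L' * L = 1) :
    ∃ σ : τ → m, (L.submatrix σ id).det ≠ 0 := by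
  by_contra! hall
  have h1 : (L' * L).det = 0 := by
    -- The rows of `L' * L` are combinations of rows of `L`; multilinear expansion of the
    -- determinant then leaves only minors of `L`.
    have : (L' * L) = fun k => ∑ j, L' k j • L.row j := by
      ext k l
      simp [mul_apply, row]
    rw [this]
    refine ((detRowAlternating (R := K) (n := τ)).toMultilinearMap.map_sum
      (fun k j => L' k j • L.row j)).trans ?_
    refine Finset.sum_eq_zero fun σ _ => ?_
    rw [MultilinearMap.map_smul_univ]
    exact smul_eq_zero_of_right _ (hall σ)
  rw [h, det_one] at h1
  exact one_ne_zero h1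

omit [Fintype m] [DecidableEq m] in
/-- Cramer's rule for the rows of a rectangular matrix. -/
theorem eq_minors_mul_submatrix (X : Matrix m τ K) (σ : τ → m)
    (h : (X.submatrix σ id).det ≠ 0) :
    X = (Matrix.of fun i k => (X.submatrix σ id).det⁻¹ *
      (X.submatrix (Function.update σ k i) id).det) * X.submatrix σ id := by
  have key : (Matrix.of fun i k => (X.submatrix σ id).det⁻¹ *
      (X.submatrix (Function.update σ k i) id).det) = X * (X.submatrix σ id)⁻¹ := by
    ext i k
    have h1 : X.submatrix (Function.update σ k i) id = (X.submatrix σ id).updateRow k (X i) := by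
      ext a b
      by_cases hak : a = k
      · subst hak; simp
      · simp [hak]
    rw [of_apply, h1, ← cramer_transpose_apply, cramer_eq_adjugate_mulVec, inv_def,
      Ring.inverse_eq_inv', Matrix.mul_smul, Matrix.smul_apply, smul_eq_mul, ← adjugate_transpose,
      mulVec_transpose]
    rfl
  rw [key, Matrix.mul_assoc, nonsing_inv_mul _ (isUnit_iff_ne_zero.mpr h), Matrix.mul_one]

theorem exists_eq_orderEmbOfFin_comp_perm {n s : ℕ} {g : Fin s → Fin n}
    (hg : Function.Injective g) :
    ∃ (I : Finset (Fin n)) (hI : I.card = s) (π : Equiv.Perm (Fin s)),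
      g = I.orderEmbOfFin hI ∘ π := by
  have hI : (Finset.univ.image g).card = s := by
    rw [Finset.card_image_of_injective _ hg, Finset.card_univ, Fintype.card_fin]
  have hm : ∀ k, g k ∈ Finset.univ.image g := fun k => Finset.mem_image_of_mem _ (Finset.mem_univ k)
  let f : Fin s → Fin s := fun k => ((Finset.univ.image g).orderIsoOfFin hI).symm ⟨g k, hm k⟩
  have hf : Function.Injective f := fun a b hab => hg (by
    simpa using ((Finset.univ.image g).orderIsoOfFin hI).symm.injective hab)
  refine ⟨_, hI, Equiv.ofBijective f (Finite.injective_iff_bijective.mp hf), ?_⟩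
  ext k
  simp only [Function.comp_apply, Equiv.ofBijective_apply, f]
  rw [← Finset.coe_orderIsoOfFin_apply, OrderIso.apply_symm_apply]

/-- The symmetry, known for increasing index sets, extends to arbitrary index maps: a repeated index
makes both sides zero, and reordering multiplies both sides by the same two signs. -/
theorem det_submatrix_comm_of_compound_isSymm {n s : ℕ} {B : Matrix (Fin n) (Fin n) K}
    (hB : (compound s B).IsSymm) (g h : Fin s → Fin n) :
    (B.submatrix g h).det = (B.submatrix h g).det := by
  have aux : ∀ g h : Fin s → Fin n, ¬ Function.Injective g →
      (B.submatrix g h).det = 0 ∧ (B.submatrix h g).det = 0 := by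
    intro g h hg
    obtain ⟨a, b, hab, hne⟩ := Function.not_injective_iff.mp hg
    exact ⟨det_zero_of_row_eq hne (by ext; simp [hab]),
      det_zero_of_column_eq hne (by intro; simp [hab])⟩
  by_cases hg : Function.Injective g
  swap
  · rw [(aux g h hg).1, (aux g h hg).2]
  by_cases hh : Function.Injective h
  swap
  · rw [(aux h g hh).1, (aux h g hh).2]
  obtain ⟨I, hI, π, rfl⟩ := exists_eq_orderEmbOfFin_comp_perm hg
  obtain ⟨J, hJ, π', rfl⟩ := exists_eq_orderEmbOfFin_comp_perm hh
  have perm : ∀ (f f' : Fin s → Fin n) (π π' : Equiv.Perm (Fin s)),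
      (B.submatrix (f ∘ π) (f' ∘ π')).det =
        Equiv.Perm.sign π * (Equiv.Perm.sign π' * (B.submatrix f f').det) := by
    intro f f' π π'
    rw [← det_permute', ← det_permute]
    rfl
  rw [perm, perm, show (B.submatrix (I.orderEmbOfFin hI) (J.orderEmbOfFin hJ)).det =
    (B.submatrix (J.orderEmbOfFin hJ) (I.orderEmbOfFin hI)).det from
      (hB.apply ⟨I, hI⟩ ⟨J, hJ⟩).symm]
  ring

/-- If `B` has rank `s` and its `s`-th compound matrix is symmetric, then the row and column spaces
of `B` coincide. -/
theorem isSupported_of_compound_isSymm {n s : ℕ} {B : Matrix (Fin n) (Fin n) K}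
    (hs : B.rank = s) (hB : (compound s B).IsSymm) : IsSupported (Fin s) B := by
  obtain ⟨P, P', Q, Q', hPQ, hP, hQ⟩ := exists_full_rank_factorization B hs
  have hQ' : Q'ᵀ * Qᵀ = 1 := by rw [← transpose_mul, hQ, transpose_one]
  obtain ⟨σ, hσ⟩ := exists_det_submatrix_ne_zero hP
  obtain ⟨σ', hσ'⟩ := exists_det_submatrix_ne_zero hQ'
  -- The two Plücker vectors are proportional: the minors of `B = P * Q` are products of a minor of
  -- `P` and a minor of `Q`.
  have key : ∀ g h : Fin s → Fin n, (P.submatrix g id).det * (Qᵀ.submatrix h id).det =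
      (P.submatrix h id).det * (Qᵀ.submatrix g id).det := by
    have : ∀ g h : Fin s → Fin n, (P.submatrix g id).det * (Qᵀ.submatrix h id).det =
        (B.submatrix g h).det := by
      intro g h
      have e : B.submatrix g h = P.submatrix g id * (Qᵀ.submatrix h id)ᵀ := by
        conv_lhs => rw [hPQ]
        rfl
      rw [e, det_mul, det_transpose (Qᵀ.submatrix h id)]
    intro g h
    rw [this, this, det_submatrix_comm_of_compound_isSymm hB]
  have hσQ : (Qᵀ.submatrix σ id).det ≠ 0 := by
    intro h0
    have := key σ σ'
    rw [h0, mul_zero] at this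
    exact mul_ne_zero hσ hσ' this
  have eP := eq_minors_mul_submatrix P σ hσ
  have eQ := eq_minors_mul_submatrix Qᵀ σ hσQ
  -- By Cramer's rule `P` and `Qᵀ` are determined by their `σ`-blocks and by ratios of minors. These
  -- ratios agree, so `Θ` is a common normalized basis of both column spaces.
  set Θ := (Matrix.of fun i k => (P.submatrix σ id).det⁻¹ *
      (P.submatrix (Function.update σ k i) id).det) with hΘ
  have hΘ' : (Matrix.of fun i k => (Qᵀ.submatrix σ id).det⁻¹ *
      (Qᵀ.submatrix (Function.update σ k i) id).det) = Θ := by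
    ext i k
    rw [hΘ, of_apply, of_apply]
    field_simp
    linear_combination key σ (Function.update σ k i)
  rw [hΘ'] at eQ
  refine ⟨Θ, P.submatrix σ id * P', P.submatrix σ id * (Qᵀ.submatrix σ id)ᵀ, ?_, ?_⟩
  · rw [Matrix.mul_assoc, mul_eq_one_comm, Matrix.mul_assoc, ← eP, hP]
  · rw [← Matrix.mul_assoc, ← eP, Matrix.mul_assoc, ← transpose_mul, ← eQ, transpose_transpose,
      ← hPQ]

theorem IsSupported.compound_isSymm {n s : ℕ} {B : Matrix (Fin n) (Fin n) K}
    (h : IsSupported (Fin s) B) : (compound s B).IsSymm := by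
  obtain ⟨L, L', S, -, rfl⟩ := h
  have : ∀ g h : Fin s → Fin n, ((L * S * Lᵀ).submatrix g h).det =
      (L.submatrix g id).det * S.det * (L.submatrix h id).det := by
    intro g h
    have e : (L * S * Lᵀ).submatrix g h = L.submatrix g id * S * (L.submatrix h id)ᵀ := rfl
    rw [e, det_mul, det_mul, det_transpose]
  refine Matrix.IsSymm.ext fun I J => ?_
  rw [compound, of_apply, of_apply, this, this]
  ring

/-- A matrix with given kernel, congruent to a given nonsingular matrix. -/
theorem IsSupported.exists_annihilating (hc : Fintype.card m = Fintype.card ρ + Fintype.card τ)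
    {B : Matrix m m K} (h : IsSupported τ B) {S : Matrix ρ ρ K} (hS : S.det ≠ 0) {ε : K}
    (hSε : Sᵀ = ε • S) :
    ∃ A : Matrix m m K, A.rank = Fintype.card ρ ∧ Aᵀ = ε • A ∧ A * B = 0 ∧ B * A = 0 := by
  obtain ⟨W, W', hW, h1, h2⟩ := h.exists_mul_eq_zero (ρ := ρ) hc
  -- `B` and `Bᵀ` both kill `W`, so this product is annihilated by `B` on both sides, and it
  -- inherits the symmetry type of `S`.
  refine ⟨W * S * Wᵀ, le_antisymm ?_ ?_, ?_, ?_, ?_⟩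
  · exact (rank_mul_le_right _ _).trans ((rank_le_card_height _).trans le_rfl)
  · have : S = W' * (W * S * Wᵀ) * W'ᵀ := by
      rw [Matrix.mul_assoc, Matrix.mul_assoc _ Wᵀ, ← transpose_mul, hW, transpose_one,
        Matrix.mul_one, ← Matrix.mul_assoc, hW, Matrix.one_mul]
    rw [← rank_of_det_ne_zero hS]
    conv_lhs => rw [this]
    exact (rank_mul_le_left _ _).trans (rank_mul_le_right _ _)
  · rw [transpose_mul, transpose_mul, transpose_transpose, hSε, ← Matrix.mul_assoc]
    simp
  · rw [Matrix.mul_assoc, ← transpose_transpose B, ← transpose_mul, h2, transpose_zero,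
      Matrix.mul_zero]
  · rw [← Matrix.mul_assoc, ← Matrix.mul_assoc, h1, Matrix.zero_mul, Matrix.zero_mul]

/-- The columns of `M = A * N'` are a basis of the image of `A`. They are killed by `B` because `B *
A = 0`, and by `Bᵀ` because transposing `A * B = 0` gives `Bᵀ * A = 0` when `Aᵀ = ε • A`. -/
theorem isSupported_of_annihilating {A B : Matrix m m K}
    {k : ℕ} (hk : A.rank = k) (hc : Fintype.card m = k + Fintype.card τ) {ε : K} (hε : ε ≠ 0) (hA : Aᵀ = ε • A)
    (h1 : A * B = 0) (h2 : B * A = 0) : IsSupported τ B := by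
  obtain ⟨M, M', N, N', hMN, hM, hN⟩ := exists_full_rank_factorization A hk
  have hMA : A * N' = M := by
    conv_lhs => rw [hMN]
    rw [Matrix.mul_assoc, hN, Matrix.mul_one]
  refine isSupported_of_mul_eq_zero (ρ := Fin k) (by simpa using hc) hM ?_ ?_
  · rw [← hMA, ← Matrix.mul_assoc, h2, Matrix.zero_mul]
  · have h3 : Bᵀ * A = 0 := by
      have := congrArg transpose h1
      rw [transpose_mul, hA, Matrix.mul_smul, transpose_zero] at this
      exact (smul_eq_zero.mp this).resolve_left hε
    rw [← hMA, ← Matrix.mul_assoc, h3, Matrix.zero_mul]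

/-- The rank of a skew-symmetric matrix is even. -/
theorem even_rank_of_transpose_eq_neg [CharZero K] {A : Matrix m m K} (hA : Aᵀ = -A) :
    Even A.rank := by
  obtain ⟨k, hk⟩ : ∃ k, A.rank = k := ⟨_, rfl⟩
  obtain ⟨M, M', N, N', hMN, hM, hN⟩ := exists_full_rank_factorization A hk
  rw [hk]
  have hN' : Nᵀ = -(A * M'ᵀ) := by
    rw [← Matrix.neg_mul, ← hA, ← transpose_mul, hMN, ← Matrix.mul_assoc, hM, Matrix.one_mul]
  have hNS : Nᵀ = -(M * (N * M'ᵀ)) := by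
    rw [hN', ← Matrix.mul_assoc, ← hMN]
  -- `N * M'ᵀ` equals `M' * A * M'ᵀ`: an invertible skew matrix of size `k = A.rank`, whose
  -- determinant would vanish for odd `k`.
  have hdet : (N * M'ᵀ).det ≠ 0 := by
    have h1 : -(N'ᵀ * M) * (N * M'ᵀ) = 1 := by
      rw [Matrix.neg_mul, Matrix.mul_assoc, ← Matrix.mul_neg, ← hNS, ← transpose_mul, hN,
        transpose_one]
    intro h0
    have := congrArg det h1
    rw [det_mul, h0, mul_zero, det_one] at this
    exact zero_ne_one this
  have hskew : (N * M'ᵀ)ᵀ = -(N * M'ᵀ) := by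
    rw [transpose_mul, transpose_transpose, hNS, Matrix.mul_neg, ← Matrix.mul_assoc, hM,
      Matrix.one_mul]
  by_contra hodd
  have h2 := congrArg det hskew
  rw [det_transpose, det_neg, Fintype.card_fin, (Nat.not_even_iff_odd.mp hodd).neg_one_pow,
    neg_one_mul] at h2
  exact hdet (self_eq_neg.mp h2)

end MatrixLemmas

/-! ### The product parametrization, bordered minors and dual numbers. -/

section Ideal

variable {K : Type*} [Field K] {m ρ τ : Type} [Fintype m] [DecidableEq m]
  [Fintype ρ] [DecidableEq ρ] [Fintype τ] [DecidableEq τ]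

/-- A full-rank factorization padded with zero columns and rows outside the image of `σ`, by
inserting `P * Pᵀ = 1`. -/
theorem exists_factorization_of_embedding (A : Matrix m m K) (σ : Fin A.rank ↪ ρ) :
    ∃ (M : Matrix m ρ K) (N : Matrix ρ m K), A = M * N ∧
      ∀ c ∉ Set.range σ, (∀ i, M i c = 0) ∧ ∀ j, N c j = 0 := by
  obtain ⟨M, -, N, -, hMN, -, -⟩ := exists_full_rank_factorization A rfl
  let P : Matrix (Fin A.rank) ρ K := (1 : Matrix ρ ρ K).submatrix σ id
  have hP : P * Pᵀ = 1 := by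
    simp only [P, transpose_submatrix, transpose_one]
    rw [← submatrix_mul _ _ _ _ _ Function.bijective_id, Matrix.one_mul, submatrix_one _ σ.injective]
  have hP0 : ∀ c ∉ Set.range σ, ∀ a, P a c = 0 := fun c hc a =>
    one_apply_ne fun h => hc ⟨a, h⟩
  refine ⟨M * P, Pᵀ * N, ?_, fun c hc => ⟨fun i => ?_, fun j => ?_⟩⟩
  · rw [← Matrix.mul_assoc, Matrix.mul_assoc M, hP, Matrix.mul_one, ← hMN]
  · rw [mul_apply]
    exact Finset.sum_eq_zero fun a _ => by rw [hP0 c hc, mul_zero]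
  · rw [mul_apply]
    exact Finset.sum_eq_zero fun a _ => by rw [transpose_apply, hP0 c hc, zero_mul]

theorem exists_factorization_of_rank_le {A : Matrix m m K} (h : A.rank ≤ Fintype.card ρ) :
    ∃ (M : Matrix m ρ K) (N : Matrix ρ m K), A = M * N := by
  obtain ⟨σ⟩ : Nonempty (Fin A.rank ↪ ρ) := Function.Embedding.nonempty_of_card_le (by simpa using h)
  obtain ⟨M, N, hMN, -⟩ := exists_factorization_of_embedding A σ
  exact ⟨M, N, hMN⟩

theorem exists_factorization_of_rank_lt {A : Matrix m m K} (h : A.rank < Fintype.card ρ) :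
    ∃ (M : Matrix m ρ K) (N : Matrix ρ m K) (c : ρ), A = M * N ∧
      (∀ i, M i c = 0) ∧ ∀ j, N c j = 0 := by
  obtain ⟨σ⟩ : Nonempty (Fin A.rank ↪ ρ) :=
    Function.Embedding.nonempty_of_card_le (by simpa using h.le)
  obtain ⟨M, N, hMN, h0⟩ := exists_factorization_of_embedding A σ
  obtain ⟨c, hc⟩ : ∃ c, c ∉ Set.range σ := by
    by_contra! hall
    have := Fintype.card_le_of_surjective σ hall
    rw [Fintype.card_fin] at this
    omega
  exact ⟨M, N, c, hMN, h0 c hc⟩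

/-- The parametrization of the matrices of rank at most `card ρ` by products of an `m × ρ` and a
`ρ × m` matrix, on polynomials. -/
noncomputable def prodMap (K : Type*) [Field K] (m ρ : Type) [Fintype ρ] :
    MvPolynomial (m × m) K →ₐ[K] MvPolynomial (m × ρ ⊕ ρ × m) K :=
  MvPolynomial.aeval fun p => ∑ k, MvPolynomial.X (Sum.inl (p.1, k)) *
    MvPolynomial.X (Sum.inr (k, p.2))

-- The algebra `R` is arbitrary so that `R` can be the dual numbers: a polynomial in the kernel of
-- `prodMap` then also has vanishing derivatives along factored directions.
omit [Fintype m] [DecidableEq m] [DecidableEq ρ] in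
theorem aeval_mul_eq {R : Type*} [CommRing R] [Algebra K R] (M : Matrix m ρ R) (N : Matrix ρ m R)
    (f : MvPolynomial (m × m) K) :
    MvPolynomial.aeval (fun p => (M * N) p.1 p.2) f =
      MvPolynomial.aeval (Sum.elim (fun p => M p.1 p.2) (fun p => N p.1 p.2))
        (prodMap K m ρ f) := by
  rw [prodMap, ← AlgHom.comp_apply, MvPolynomial.comp_aeval]
  congr 2
  ext p
  simp [mul_apply]

omit [Fintype m] [DecidableEq m] [DecidableEq ρ] in
theorem prodMap_eq_zero_iff [Infinite K] (f : MvPolynomial (m × m) K) :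
    prodMap K m ρ f = 0 ↔ ∀ (M : Matrix m ρ K) (N : Matrix ρ m K),
      MvPolynomial.eval (fun p => (M * N) p.1 p.2) f = 0 := by
  constructor
  · intro h M N
    have := aeval_mul_eq M N f
    rwa [h, map_zero, MvPolynomial.aeval_eq_eval] at this
  · intro h
    refine MvPolynomial.funext fun x => ?_
    have := aeval_mul_eq (R := K) (Matrix.of fun i k => x (Sum.inl (i, k)))
      (Matrix.of fun k j => x (Sum.inr (k, j))) f
    rw [MvPolynomial.aeval_eq_eval] at this
    have h2 := h (Matrix.of fun i k => x (Sum.inl (i, k))) (Matrix.of fun k j => x (Sum.inr (k, j)))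
    rw [map_zero]
    erw [h2] at this
    rw [MvPolynomial.aeval_eq_eval] at this
    convert this.symm using 2
    congr 1
    ext p
    rcases p with p | p <;> rfl

/-- The bordered minor with corner entry `(i, j)` bordering the block with rows and columns `ε`. -/
def borderedMinor {R : Type*} [CommRing R] (Z : Matrix m m R) (ε : ρ → m) (i j : m) : R :=
  Z i j * (Z.submatrix ε ε).det -
    (Z.submatrix id ε * (Z.submatrix ε ε).adjugate * Z.submatrix ε id) i j

omit [Fintype m] [DecidableEq m] in
theorem map_borderedMinor {R S : Type*} [CommRing R] [CommRing S] (f : R →+* S) (Z : Matrix m m R)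
    (ε : ρ → m) (i j : m) : f (borderedMinor Z ε i j) = borderedMinor (Z.map f) ε i j := by
  have h1 : ((Z.map f).submatrix id ε * ((Z.map f).submatrix ε ε).adjugate *
      (Z.map f).submatrix ε id) = (Z.submatrix id ε * (Z.submatrix ε ε).adjugate *
        Z.submatrix ε id).map f := by
    rw [Matrix.map_mul, Matrix.map_mul, ← RingHom.mapMatrix_apply f (adjugate _),
      RingHom.map_adjugate]
    rfl
  rw [borderedMinor, borderedMinor, h1, map_sub, map_mul, RingHom.map_det]
  rfl

-- The adjugate reverses the product of the two corner blocks, so each factor meets its own adjugate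
-- and contributes its determinant. No inverse is needed, and the identity holds over any
-- commutative ring.
omit [Fintype m] [DecidableEq m] in
theorem borderedMinor_mul {R : Type*} [CommRing R] (M : Matrix m ρ R) (N : Matrix ρ m R)
    (ε : ρ → m) (i j : m) : borderedMinor (M * N) ε i j = 0 := by
  have h1 : (M * N).submatrix id ε = M * N.submatrix id ε := rfl
  have h2 : (M * N).submatrix ε id = M.submatrix ε id * N := rfl
  have h3 : (M * N).submatrix ε ε = M.submatrix ε id * N.submatrix id ε := rfl
  have h4 : M * N.submatrix id ε * (M.submatrix ε id * N.submatrix id ε).adjugate *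
      (M.submatrix ε id * N) =
      ((M.submatrix ε id * N.submatrix id ε).det) • (M * N) := by
    rw [adjugate_mul_distrib]
    calc _ = M * (N.submatrix id ε * (N.submatrix id ε).adjugate) *
          ((M.submatrix ε id).adjugate * M.submatrix ε id) * N := by
          simp only [Matrix.mul_assoc]
      _ = _ := by
          rw [mul_adjugate, adjugate_mul, det_mul]
          simp [smul_smul]
  rw [borderedMinor, h1, h2, h3, h4, Matrix.smul_apply, smul_eq_mul]
  ring

-- In the correction term the two outer factors are both infinitesimal, so it vanishes to second
-- order; the corner determinant is `1` modulo the infinitesimal. Hence the derivative of the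
-- bordered minor is just its corner entry.
open TrivSqZeroExt in
omit [Fintype m] [DecidableEq m] in
theorem snd_borderedMinor (Z : Matrix m m (DualNumber K)) {ε : ρ → m} {i j : m}
    (h0 : fst (Z i j) = 0) (h1 : ∀ k, fst (Z i (ε k)) = 0) (h2 : ∀ k, fst (Z (ε k) j) = 0)
    (h3 : ∀ k l, fst (Z (ε k) (ε l)) = (1 : Matrix ρ ρ K) k l) :
    snd (borderedMinor Z ε i j) = snd (Z i j) := by
  have hd : fst (Z.submatrix ε ε).det = 1 := by
    have := RingHom.map_det (fstHom K K K).toRingHom (Z.submatrix ε ε)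
    rw [show (fstHom K K K).toRingHom.mapMatrix (Z.submatrix ε ε) = 1 from
      Matrix.ext fun k l => h3 k l, det_one] at this
    exact this
  have hs : snd ((Z.submatrix id ε * (Z.submatrix ε ε).adjugate * Z.submatrix ε id) i j) = 0 := by
    rw [mul_apply, snd_sum]
    refine Finset.sum_eq_zero fun k _ => ?_
    have hf : fst ((Z.submatrix id ε * (Z.submatrix ε ε).adjugate) i k) = 0 := by
      rw [mul_apply, fst_sum]
      refine Finset.sum_eq_zero fun l _ => ?_
      rw [fst_mul, submatrix_apply, id, h1, zero_mul]
    rw [snd_mul, hf, submatrix_apply, id, h2]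
    simp
  rw [borderedMinor, snd_sub, hs, sub_zero, snd_mul, h0, hd]
  simp

open TrivSqZeroExt in
/-- Evaluation at a dual number computes directional derivatives. -/
theorem aeval_dualNumber {ι : Type*} [Fintype ι] (a w : ι → K) (f : MvPolynomial ι K) :
    fst (MvPolynomial.aeval (fun i => (inl (a i) + inr (w i) : DualNumber K)) f) =
        MvPolynomial.eval a f ∧
      snd (MvPolynomial.aeval (fun i => (inl (a i) + inr (w i) : DualNumber K)) f) =
        ∑ i, MvPolynomial.eval a (MvPolynomial.pderiv i f) * w i := by
  classical
  induction f using MvPolynomial.induction_on with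
  | C c =>
    simp [algebraMap_eq_inl]
  | add p q hp hq =>
    simp only [map_add, fst_add, snd_add, hp.1, hq.1, hp.2, hq.2, add_mul,
      Finset.sum_add_distrib, and_self]
  | mul_X p i hp =>
    refine ⟨by rw [map_mul, fst_mul, hp.1, MvPolynomial.aeval_X, map_mul, MvPolynomial.eval_X]; simp,
      ?_⟩
    simp only [map_mul, MvPolynomial.aeval_X, snd_mul, hp.1, hp.2, Derivation.leibniz, map_add,
      smul_eq_mul, MvPolynomial.pderiv_X, MvPolynomial.eval_X, add_mul, Finset.sum_add_distrib,
      fst_add, snd_add, fst_inl, fst_inr, snd_inl, snd_inr, MulOpposite.smul_eq_mul_unop,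
      MulOpposite.unop_op, add_zero, zero_add]
    congr 1
    · simp [Pi.single_apply, apply_ite]
    · rw [Finset.sum_mul]
      exact Finset.sum_congr rfl fun k _ => by ring

end Ideal

/-! ### The ideal of the determinantal variety. -/

section DeterminantalIdeal

variable {K : Type*} [Field K] {ρ τ : Type}
  [Fintype ρ] [DecidableEq ρ] [Fintype τ] [DecidableEq τ] {N r : ℕ}

theorem rank_smul_of_ne_zero {m n : Type*} [Fintype m] [Fintype n] {c : K} (hc : c ≠ 0)
    (A : Matrix m n K) : (c • A).rank = A.rank :=
  rank_smul_of_mem_nonZeroDivisors A (mem_nonZeroDivisors_of_ne_zero hc)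

theorem exists_toMat_mk (A : Matrix (Fin (N + 1)) (Fin (N + 1)) K)
    (h : (fun p : Fin (N + 1) × Fin (N + 1) => A p.1 p.2) ≠ 0) :
    ∃ c : K, c ≠ 0 ∧ toMat (Projectivization.mk K _ h) = c • A := by
  obtain ⟨a, ha⟩ := Projectivization.exists_smul_eq_mk_rep K _ h
  refine ⟨a, a.ne_zero, ?_⟩
  ext i j
  rw [toMat, of_apply, ← ha]
  rfl

theorem mem_coneOver_detVar {v : Fin (N + 1) × Fin (N + 1) → K} :
    v ∈ coneOver (detVar K N r) ↔ v ≠ 0 ∧ (Matrix.of fun i j => v (i, j)).rank ≤ r := by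
  constructor
  · rintro ⟨h, hv⟩
    obtain ⟨c, hc, e⟩ := exists_toMat_mk (Matrix.of fun i j => v (i, j)) h
    refine ⟨h, ?_⟩
    rw [← rank_smul_of_ne_zero hc, ← e]
    exact hv
  · rintro ⟨h, hv⟩
    obtain ⟨c, hc, e⟩ := exists_toMat_mk (Matrix.of fun i j => v (i, j)) h
    refine ⟨h, ?_⟩
    rw [← rank_smul_of_ne_zero hc, ← e] at hv
    exact hv

/-- The density argument used throughout: the restriction of `f` to a line is a one-variable
polynomial, which is zero once it has infinitely many roots. -/
theorem eval_eq_zero_of_eval_line {ι : Type*} [Infinite K] (f : MvPolynomial ι K) (a b : ι → K)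
    {s : Set K} (hs : s.Finite)
    (h : ∀ t ∉ s, MvPolynomial.eval (a + t • b) f = 0) : MvPolynomial.eval a f = 0 := by
  let p : Polynomial K :=
    MvPolynomial.aeval (fun i => Polynomial.C (a i) + Polynomial.X * Polynomial.C (b i)) f
  have hp : ∀ t, p.eval t = MvPolynomial.eval (a + t • b) f := by
    intro t
    rw [← Polynomial.coe_aeval_eq_eval, ← MvPolynomial.aeval_eq_eval]
    simp only [p]
    rw [← AlgHom.comp_apply, MvPolynomial.comp_aeval]
    congr 2
    ext i
    simp
    ring
  have h0 : p = 0 := by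
    refine Polynomial.eq_zero_of_infinite_isRoot p
      (hs.infinite_compl.mono fun t ht => ?_)
    rw [Set.mem_ofPred_eq, Polynomial.IsRoot, hp, h t ht]
  have := hp 0
  rw [h0, Polynomial.eval_zero, zero_smul, add_zero] at this
  exact this.symm

/-- The ideal of the determinantal variety is the kernel of a map of polynomial rings. -/
theorem idealOf_detVar [Infinite K] (hr : 1 ≤ r) (hρ : Fintype.card ρ = r) :
    idealOf (detVar K N r) = RingHom.ker (prodMap K (Fin (N + 1)) ρ) := by
  ext f
  rw [RingHom.mem_ker, prodMap_eq_zero_iff, idealOf, MvPolynomial.mem_vanishingIdeal_iff]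
  simp only [mem_coneOver_detVar, MvPolynomial.aeval_eq_eval]
  constructor
  · intro h M N'
    have hle : (M * N').rank ≤ r := by
      rw [← hρ]
      exact (rank_mul_le_left _ _).trans M.rank_le_card_width
    by_cases h0 : (fun p : Fin (N + 1) × Fin (N + 1) => (M * N') p.1 p.2) = 0
    -- `coneOver` omits the origin, so the value at the zero matrix is recovered from the line of
    -- multiples of a matrix unit, which has rank at most `1 ≤ r`.
    · rw [h0]
      refine eval_eq_zero_of_eval_line f 0 (Pi.single (0, 0) 1)
        (Set.finite_singleton 0) fun t ht => h _ ⟨?_, ?_⟩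
      · rw [zero_add]
        intro h1
        have := congrFun h1 (0, 0)
        exact ht (by simpa using this)
      · refine le_trans ?_ hr
        have : (Matrix.of fun i j => (0 + t • Pi.single (0, 0) 1 :
            Fin (N + 1) × Fin (N + 1) → K) (i, j)) =
            vecMulVec (Pi.single (0 : Fin (N + 1)) t) (Pi.single (0 : Fin (N + 1)) 1) := by
          ext i j
          by_cases hi : i = 0 <;> by_cases hj : j = 0 <;> simp [vecMulVec, hi, hj]
        rw [this]
        exact rank_vecMulVec_le _ _
    · exact h _ ⟨h0, hle⟩
  · rintro h v ⟨-, hv⟩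
    obtain ⟨M, N', hMN⟩ := exists_factorization_of_rank_le (ρ := ρ) (hv.trans hρ.ge)
    have := h M N'
    rw [← hMN] at this
    exact this

theorem aeval_eq_zero_of_mem_idealOf [Infinite K] (hr : 1 ≤ r) (hρ : Fintype.card ρ = r)
    {R : Type*} [CommRing R] [Algebra K R] {f : MvPolynomial (Fin (N + 1) × Fin (N + 1)) K}
    (hf : f ∈ idealOf (detVar K N r)) (M : Matrix (Fin (N + 1)) ρ R)
    (N' : Matrix ρ (Fin (N + 1)) R) :
    MvPolynomial.aeval (fun p => (M * N') p.1 p.2) f = 0 := by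
  rw [idealOf_detVar hr hρ, RingHom.mem_ker] at hf
  rw [aeval_mul_eq, hf, map_zero]

theorem mem_idealOf_iff [Infinite K] (hr : 1 ≤ r) (hρ : Fintype.card ρ = r)
    {f : MvPolynomial (Fin (N + 1) × Fin (N + 1)) K} :
    f ∈ idealOf (detVar K N r) ↔ ∀ (M : Matrix (Fin (N + 1)) ρ K) (N' : Matrix ρ (Fin (N + 1)) K),
      MvPolynomial.eval (fun p => (M * N') p.1 p.2) f = 0 := by
  rw [idealOf_detVar hr hρ, RingHom.mem_ker, prodMap_eq_zero_iff]

/-- The matrix of coordinate functions. -/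
noncomputable def genericMat (K : Type*) [Field K] (m : Type) : Matrix m m (MvPolynomial (m × m) K) :=
  Matrix.of fun i j => MvPolynomial.X (i, j)

theorem genericMat_map {R : Type*} [CommRing R] [Algebra K R] {m : Type} (Z : Matrix m m R) :
    (genericMat K m).map (MvPolynomial.aeval (R := K) fun p => Z p.1 p.2) = Z := by
  ext i j
  simp [genericMat]

theorem borderedMinor_genericMat_mem [Infinite K] (hr : 1 ≤ r) (hρ : Fintype.card ρ = r)
    (ε : ρ → Fin (N + 1)) (i j : Fin (N + 1)) :
    borderedMinor (genericMat K (Fin (N + 1))) ε i j ∈ idealOf (detVar K N r) := by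
  rw [mem_idealOf_iff hr hρ]
  intro M N'
  rw [← MvPolynomial.aeval_eq_eval]
  refine (map_borderedMinor (MvPolynomial.aeval (R := K)
    fun p : Fin (N + 1) × Fin (N + 1) => (M * N') p.1 p.2).toRingHom _ _ _ _).trans ?_
  have := genericMat_map (K := K) (M * N')
  refine Eq.trans ?_ (borderedMinor_mul M N' ε i j)
  congr 1

end DeterminantalIdeal

/-! ### Tangent spaces of the determinantal variety. -/

section TangentSpace

open TrivSqZeroExt

variable {K : Type*} [Field K] {ρ τ : Type}
  [Fintype ρ] [DecidableEq ρ] [Fintype τ] [DecidableEq τ] {N r : ℕ}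

theorem mem_tangentSpace_iff {X : Set (MatProj K N)} {x : MatProj K N}
    {w : Fin (N + 1) × Fin (N + 1) → K} :
    w ∈ tangentSpace X x ↔ ∀ f ∈ idealOf X, snd (MvPolynomial.aeval
      (fun p => (inl (toMat x p.1 p.2) + inr (w p) : DualNumber K)) f) = 0 := by
  refine forall₂_congr fun f _ => ?_
  rw [← (aeval_dualNumber x.rep w f).2]
  rfl

/-- At a matrix of less than the generic rank, the tangent space is the full space. -/
theorem tangentSpace_eq_top [Infinite K] (hr : 1 ≤ r) {x : MatProj K N}
    (hx : (toMat x).rank < r) : tangentSpace (detVar K N r) x = ⊤ := by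
  obtain ⟨M, N', c, hMN, hM, hN⟩ := exists_factorization_of_rank_lt (ρ := Fin r)
    (by simpa using hx)
  have hs : ∀ q, Pi.single q 1 ∈ tangentSpace (detVar K N r) x := by
    rintro ⟨a, b⟩
    rw [mem_tangentSpace_iff]
    intro f hf
    -- Column `c` of `M` and row `c` of `N'` are zero. Adding an infinitesimal at `(a, c)` to the
    -- former and `1` at `(c, b)` to the latter changes the product by exactly the infinitesimal
    -- matrix unit at `(a, b)`.
    have h := aeval_eq_zero_of_mem_idealOf (R := DualNumber K) hr (Fintype.card_fin r) hf
      (Matrix.of fun i k => inl (M i k) + if i = a ∧ k = c then inr 1 else 0)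
      (Matrix.of fun k j => inl (N' k j) + if k = c ∧ j = b then 1 else 0)
    refine Eq.trans ?_ (congrArg snd h)
    congr 3
    funext ⟨i, j⟩
    rw [hMN]
    have : ∀ k, (inl (M i k) + if i = a ∧ k = c then inr 1 else 0 : DualNumber K) *
        (inl (N' k j) + if k = c ∧ j = b then 1 else 0) =
        inl (M i k * N' k j) + if k = c then inr ((Pi.single (a, b) 1 : _ → K) (i, j)) else 0 := by
      intro k
      by_cases hk : k = c
      · subst hk
        rw [hM, hN]
        by_cases hi : i = a <;> by_cases hj : j = b <;> simp [hi, hj]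
      · simp [hk, inl_mul]
    simp only [mul_apply, of_apply, this, Finset.sum_add_distrib, Finset.sum_ite_eq',
      Finset.mem_univ, if_true, inl_sum]
  rw [eq_top_iff]
  intro w _
  rw [← Finset.univ_sum_single w]
  refine Submodule.sum_mem _ fun q _ => ?_
  have := Submodule.smul_mem _ (w q) (hs q)
  rwa [← Pi.single_smul, smul_eq_mul, mul_one] at this

omit [Fintype τ] [DecidableEq τ] in
/-- The tangent space of the determinantal variety at a matrix of generic rank. -/
theorem mem_tangentSpace_detVar_iff [Infinite K] (hr : 1 ≤ r) (hρ : Fintype.card ρ = r)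
    {x : MatProj K N} {V U : Matrix (Fin (N + 1)) (Fin (N + 1)) K} (e : Fin (N + 1) ≃ ρ ⊕ τ)
    (hV : IsUnit V.det) (hU : IsUnit U.det)
    (h : V * toMat x * U = (fromBlocks 1 0 0 0).submatrix e e)
    {w : Fin (N + 1) × Fin (N + 1) → K} :
    w ∈ tangentSpace (detVar K N r) x ↔
      ∀ a b : τ, (V * (Matrix.of fun i j => w (i, j)) * U) (e.symm (Sum.inr a))
        (e.symm (Sum.inr b)) = 0 := by
  set W : Matrix (Fin (N + 1)) (Fin (N + 1)) K := Matrix.of fun i j => w (i, j) with hW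
  set ι : K →+* DualNumber K := inlHom K K
  let Z : Matrix (Fin (N + 1)) (Fin (N + 1)) (DualNumber K) :=
    Matrix.of fun i j => inl (toMat x i j) + inr (W i j)
  let Z' : Matrix (Fin (N + 1)) (Fin (N + 1)) (DualNumber K) :=
    Matrix.of fun i j => inl ((V * toMat x * U) i j) + inr ((V * W * U) i j)
  have hZ' : V.map ι * Z * U.map ι = Z' := by
    have hl : ∀ (A B : Matrix (Fin (N + 1)) (Fin (N + 1)) K),
        A.map ι * Matrix.of (fun i j => (inl (B i j) : DualNumber K)) =
          Matrix.of (fun i j => inl ((A * B) i j)) := by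
      intro A B
      ext i j <;> simp [mul_apply, ι, fst_sum, snd_sum]
    have hl' : ∀ (A B : Matrix (Fin (N + 1)) (Fin (N + 1)) K),
        Matrix.of (fun i j => (inl (B i j) : DualNumber K)) * A.map ι =
          Matrix.of (fun i j => inl ((B * A) i j)) := by
      intro A B
      ext i j <;> simp [mul_apply, ι, fst_sum, snd_sum]
    have hs : ∀ (A B : Matrix (Fin (N + 1)) (Fin (N + 1)) K),
        A.map ι * Matrix.of (fun i j => (inr (B i j) : DualNumber K)) =
          Matrix.of (fun i j => inr ((A * B) i j)) := by
      intro A B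
      ext i j <;> simp [mul_apply, ι, fst_sum, snd_sum, mul_comm]
    have hs' : ∀ (A B : Matrix (Fin (N + 1)) (Fin (N + 1)) K),
        Matrix.of (fun i j => (inr (B i j) : DualNumber K)) * A.map ι =
          Matrix.of (fun i j => inr ((B * A) i j)) := by
      intro A B
      ext i j <;> simp [mul_apply, ι, fst_sum, snd_sum]
    have e1 : Z = Matrix.of (fun i j => (inl (toMat x i j) : DualNumber K)) +
      Matrix.of (fun i j => (inr (W i j) : DualNumber K)) := rfl
    rw [e1, Matrix.mul_add, Matrix.add_mul, hl, hl', hs, hs']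
    rfl
  have hcancel : ∀ {A : Matrix (Fin (N + 1)) (Fin (N + 1)) K}, IsUnit A.det →
      A⁻¹.map ι * A.map ι = 1 ∧ A.map ι * A⁻¹.map ι = 1 := by
    intro A hA
    constructor <;> rw [← Matrix.map_mul]
    · rw [nonsing_inv_mul _ hA, Matrix.map_one _ (map_zero _) (map_one _)]
    · rw [mul_nonsing_inv _ hA, Matrix.map_one _ (map_zero _) (map_one _)]
  rw [mem_tangentSpace_iff]
  constructor
  · intro hw a b
    let ε : ρ → Fin (N + 1) := fun k => e.symm (Sum.inl k)
    set i := e.symm (Sum.inr a)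
    set j := e.symm (Sum.inr b)
    let g := borderedMinor (genericMat K (Fin (N + 1))) ε i j
    -- The bordered minor in the coordinates `V X U`, where the point is in block form; its
    -- derivative along `w` is the `(i, j)` entry of `V * W * U`.
    let f : MvPolynomial (Fin (N + 1) × Fin (N + 1)) K :=
      borderedMinor (V.map (algebraMap K _) * genericMat K (Fin (N + 1)) *
        U.map (algebraMap K _)) ε i j
    have hfe : ∀ {R : Type _} [CommRing R] [Algebra K R]
        (Y : Matrix (Fin (N + 1)) (Fin (N + 1)) R),
        MvPolynomial.aeval (R := K) (fun p : Fin (N + 1) × Fin (N + 1) => Y p.1 p.2) f =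
          borderedMinor (V.map (algebraMap K R) * Y * U.map (algebraMap K R)) ε i j := by
      intro R _ _ Y
      refine (map_borderedMinor (MvPolynomial.aeval (R := K)
        fun p : Fin (N + 1) × Fin (N + 1) => Y p.1 p.2).toRingHom _ _ _ _).trans ?_
      congr 1
      rw [Matrix.map_mul, Matrix.map_mul]
      congr 1
      · congr 1
        · ext; simp
        · exact genericMat_map Y
      · ext; simp
    have hf : f ∈ idealOf (detVar K N r) := by
      rw [mem_idealOf_iff hr hρ]
      intro M N'
      rw [← MvPolynomial.aeval_eq_eval]
      refine (hfe (M * N')).trans ?_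
      rw [← Matrix.mul_assoc, Matrix.mul_assoc]
      exact borderedMinor_mul _ _ _ _ _
    have h1 := hw f hf
    have h2 := hfe Z
    rw [show V.map (algebraMap K (DualNumber K)) * Z * U.map (algebraMap K (DualNumber K)) = Z'
      from hZ'] at h2
    have h3 : snd (borderedMinor Z' ε i j) = snd (Z' i j) := by
      refine snd_borderedMinor Z' ?_ ?_ ?_ ?_ <;> simp [Z', h, ε, i, j]
    have h4 : (V * W * U) i j = snd (Z' i j) := by simp [Z']
    rw [h4, ← h3, ← h2]
    exact h1
  · intro hw f hf
    -- With `δ² = 0`, the matrix `[1 + δA, δB; δC, 0]` is the product of the column `[1 + δA; δC]`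
    -- and the row `[1, δB]`. So `Z'` is a point of the parametrization over the dual numbers.
    let M : Matrix (Fin (N + 1)) ρ (DualNumber K) := Z'.submatrix id fun k => e.symm (Sum.inl k)
    let Q : Matrix ρ (Fin (N + 1)) (DualNumber K) := Matrix.of fun k j =>
      Sum.elim (fun l => (1 : Matrix ρ ρ (DualNumber K)) k l)
        (fun _ => inr ((V * W * U) (e.symm (Sum.inl k)) j)) (e j)
    have hMQ : Z' = M * Q := by
      ext1 i j
      obtain ⟨i, rfl⟩ := e.symm.surjective i
      obtain ⟨j, rfl⟩ := e.symm.surjective j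
      rw [mul_apply]
      rcases j with j | j
      · simp [Q, M, one_apply]
      · simp only [M, Q, Z', submatrix_apply, of_apply, id, h, Equiv.apply_symm_apply, Sum.elim_inr,
          add_mul, inr_mul_inr, add_zero]
        rcases i with i | i
        · simp [one_apply, ite_mul, apply_ite]
        · simp [hw]
    have hZ : Z = (V⁻¹.map ι * M) * (Q * U⁻¹.map ι) := by
      calc Z = (V⁻¹.map ι * V.map ι) * Z * (U.map ι * U⁻¹.map ι) := by
            rw [(hcancel hV).1, (hcancel hU).2, Matrix.one_mul, Matrix.mul_one]
        _ = V⁻¹.map ι * (V.map ι * Z * U.map ι) * U⁻¹.map ι := by simp only [Matrix.mul_assoc]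
        _ = _ := by rw [hZ', hMQ]; simp only [Matrix.mul_assoc]
    have := aeval_eq_zero_of_mem_idealOf (R := DualNumber K) hr hρ hf
      (V⁻¹.map ι * M) (Q * U⁻¹.map ι)
    rw [← hZ] at this
    exact congrArg snd this

end TangentSpace

/-! ### Dimension, smooth points and tangent hyperplanes. -/

section Smooth

variable {K : Type*} [Field K] {ρ τ : Type}
  [Fintype ρ] [DecidableEq ρ] [Fintype τ] [DecidableEq τ] {N r : ℕ}

/-- The positions outside the lower right block of a block decomposition. -/
abbrev HookIndex (e : Fin (N + 1) ≃ ρ ⊕ τ) : Type :=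
  {p : Fin (N + 1) × Fin (N + 1) // (e p.1).isLeft ∨ (e p.2).isLeft}

omit [Fintype τ] [DecidableEq τ] in
theorem finrank_tangentSpace_detVar [Infinite K] (hr : 1 ≤ r) (hρ : Fintype.card ρ = r)
    {x : MatProj K N} {V U : Matrix (Fin (N + 1)) (Fin (N + 1)) K} (e : Fin (N + 1) ≃ ρ ⊕ τ)
    (hV : IsUnit V.det) (hU : IsUnit U.det)
    (h : V * toMat x * U = (fromBlocks 1 0 0 0).submatrix e e) :
    Module.finrank K (tangentSpace (detVar K N r) x) = Fintype.card (HookIndex e) := by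
  have hlin : IsLinearMap K fun (w : tangentSpace (detVar K N r) x) (p : HookIndex e) =>
      (V * (Matrix.of fun i j => w.1 (i, j)) * U) p.1.1 p.1.2 := by
    constructor
    · intro w w'
      ext p
      have : (Matrix.of fun i j => (w + w').1 (i, j)) = (Matrix.of fun i j => w.1 (i, j)) +
        (Matrix.of fun i j => w'.1 (i, j)) := rfl
      rw [this, Matrix.mul_add, Matrix.add_mul]
      rfl
    · intro c w
      ext p
      have : (Matrix.of fun i j => (c • w).1 (i, j)) = c • (Matrix.of fun i j => w.1 (i, j)) := rfl
      rw [this, Matrix.mul_smul, Matrix.smul_mul]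
      rfl
  have hzero : ∀ (w : tangentSpace (detVar K N r) x) (i j : Fin (N + 1)),
      ¬ ((e i).isLeft ∨ (e j).isLeft) → (V * (Matrix.of fun i j => w.1 (i, j)) * U) i j = 0 := by
    intro w i j hij
    have hw := (mem_tangentSpace_detVar_iff hr hρ e hV hU h).mp w.2
    obtain ⟨i, rfl⟩ := e.symm.surjective i
    obtain ⟨j, rfl⟩ := e.symm.surjective j
    rcases i with i | i <;> rcases j with j | j <;> simp at hij
    exact hw i j
  have hbij : Function.Bijective (IsLinearMap.mk' _ hlin) := by
    constructor
    · rw [← LinearMap.ker_eq_bot, LinearMap.ker_eq_bot']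
      intro w hw
      have h0 : V * (Matrix.of fun i j => w.1 (i, j)) * U = 0 := by
        ext i j
        by_cases hij : (e i).isLeft ∨ (e j).isLeft
        · exact congrFun hw ⟨(i, j), hij⟩
        · exact hzero w i j hij
      have h1 : (Matrix.of fun i j => w.1 (i, j)) = (0 : Matrix _ _ K) := by
        have := congrArg (fun Y => V⁻¹ * Y * U⁻¹) h0
        simpa [Matrix.mul_assoc, mul_nonsing_inv U hU, nonsing_inv_mul_cancel_left V _ hV] using this
      ext p
      exact congrFun (congrFun h1 p.1) p.2
    · intro y
      let Y : Matrix (Fin (N + 1)) (Fin (N + 1)) K := Matrix.of fun i j =>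
        if hij : (e i).isLeft ∨ (e j).isLeft then y ⟨(i, j), hij⟩ else 0
      have hY : V * (Matrix.of fun i j => (V⁻¹ * Y * U⁻¹) i j) * U = Y := by
        change V * (V⁻¹ * Y * U⁻¹) * U = Y
        rw [Matrix.mul_assoc V⁻¹, mul_nonsing_inv_cancel_left V _ hV,
          nonsing_inv_mul_cancel_right U _ hU]
      refine ⟨⟨fun p => (V⁻¹ * Y * U⁻¹) p.1 p.2, ?_⟩, ?_⟩
      · rw [mem_tangentSpace_detVar_iff hr hρ e hV hU h]
        intro a b
        erw [hY]
        simp [Y]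
      · ext p
        refine (congrFun (congrFun hY p.1.1) p.1.2).trans ?_
        simp only [Y, of_apply]
        rw [dif_pos p.2]
  rw [(LinearEquiv.ofBijective _ hbij).finrank_eq, Module.finrank_fintype_fun_eq_card]

theorem isPrime_idealOf_detVar [Infinite K] (hr : 1 ≤ r) :
    (idealOf (detVar K N r)).IsPrime := by
  rw [idealOf_detVar hr (Fintype.card_fin r)]
  exact RingHom.ker_isPrime _

omit [Fintype τ] [DecidableEq τ] in
/-- A matrix with prescribed entries in the hook, of rank at most `card ρ`. -/
theorem exists_mul_eq_on_hook (e : Fin (N + 1) ≃ ρ ⊕ τ)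
    (Y : Matrix (Fin (N + 1)) (Fin (N + 1)) K)
    (hY : (Y.submatrix (fun k => e.symm (Sum.inl k)) (fun k => e.symm (Sum.inl k))).det ≠ 0) :
    ∃ (M : Matrix (Fin (N + 1)) ρ K) (Q : Matrix ρ (Fin (N + 1)) K),
      ∀ i j, (e i).isLeft ∨ (e j).isLeft → (M * Q) i j = Y i j := by
  set ε : ρ → Fin (N + 1) := fun k => e.symm (Sum.inl k)
  have hu : IsUnit (Y.submatrix ε ε).det := isUnit_iff_ne_zero.mpr hY
  have hε : ∀ i, (e i).isLeft → ∃ k, i = ε k := by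
    intro i hi
    obtain ⟨k, hk⟩ := Sum.isLeft_iff.mp hi
    exact ⟨k, by simp [ε, ← hk]⟩
  -- The rank `card ρ` completion of a hook with invertible corner block: left columns times inverse
  -- corner times top rows.
  refine ⟨Y.submatrix id ε, (Y.submatrix ε ε)⁻¹ * Y.submatrix ε id, ?_⟩
  rintro i j (hi | hj)
  · obtain ⟨k, rfl⟩ := hε i hi
    rw [← Matrix.mul_assoc]
    have : Y.submatrix ε ε * (Y.submatrix ε ε)⁻¹ * Y.submatrix ε id = Y.submatrix ε id := by
      rw [mul_nonsing_inv _ hu, Matrix.one_mul]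
    exact congrFun (congrFun this k) j
  · obtain ⟨k, rfl⟩ := hε j hj
    have : Y.submatrix id ε * ((Y.submatrix ε ε)⁻¹ * Y.submatrix ε ε) = Y.submatrix id ε := by
      rw [nonsing_inv_mul _ hu, Matrix.mul_one]
    exact congrFun (congrFun this i) k

omit [Fintype τ] [DecidableEq τ] in
/-- The coordinate functions in the hook form a transcendence basis of the coordinate ring. -/
theorem trdeg_coordinateRing_detVar [Infinite K] (hr : 1 ≤ r) (hρ : Fintype.card ρ = r)
    (e : Fin (N + 1) ≃ ρ ⊕ τ) :
    Algebra.trdeg K (MvPolynomial (Fin (N + 1) × Fin (N + 1)) K ⧸ idealOf (detVar K N r)) =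
      (Fintype.card (HookIndex e) : Cardinal) := by
  set I := idealOf (detVar K N r) with hI
  have hp : I.IsPrime := isPrime_idealOf_detVar hr
  set ε : ρ → Fin (N + 1) := fun k => e.symm (Sum.inl k) with hε
  have hεl : ∀ k, (e (ε k)).isLeft := fun k => by simp [ε]
  let x : HookIndex e → MvPolynomial (Fin (N + 1) × Fin (N + 1)) K ⧸ I := fun p =>
    Ideal.Quotient.mkₐ K I (MvPolynomial.X p.1)
  have hind : AlgebraicIndependent K x := by
    rw [algebraicIndependent_iff]
    intro g hg
    have hmem : MvPolynomial.rename Subtype.val g ∈ I := by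
      rw [← Ideal.Quotient.eq_zero_iff_mem, ← hg]
      exact (DFunLike.congr_fun (MvPolynomial.aeval_unique (Ideal.Quotient.mkₐ K I)) _).trans
        (MvPolynomial.aeval_rename _ _ _)
    rw [mem_idealOf_iff hr hρ] at hmem
    let P : Matrix ρ ρ (MvPolynomial (HookIndex e) K) :=
      Matrix.of fun k l => MvPolynomial.X ⟨(ε k, ε l), Or.inl (hεl k)⟩
    have hP : ∀ y : HookIndex e → K, MvPolynomial.eval y P.det =
        (Matrix.of fun k l => y ⟨(ε k, ε l), Or.inl (hεl k)⟩).det := by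
      intro y
      rw [RingHom.map_det]
      congr 1
      ext k l
      simp [P]
    have hP0 : P.det ≠ 0 := by
      intro h0
      have h1 := hP fun p => (1 : Matrix _ _ K) p.1.1 p.1.2
      rw [h0, map_zero] at h1
      have h2 : (Matrix.of fun k l => (1 : Matrix _ _ K) (ε k) (ε l)) = (1 : Matrix ρ ρ K) :=
        submatrix_one ε (e.symm.injective.comp Sum.inl_injective)
      erw [h2, det_one] at h1
      exact zero_ne_one h1
    -- Where the corner determinant is nonzero, every assignment of the hook variables extends to a
    -- matrix of rank at most `r`, so the relation `g` vanishes there.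
    have hprod : g * P.det = 0 := by
      refine MvPolynomial.funext fun y => ?_
      rw [map_mul, map_zero]
      by_cases hy : MvPolynomial.eval y P.det = 0
      · rw [hy, mul_zero]
      · rw [hP] at hy
        obtain ⟨M, Q, hMQ⟩ := exists_mul_eq_on_hook e (Matrix.of fun i j =>
          if hij : (e i).isLeft ∨ (e j).isLeft then y ⟨(i, j), hij⟩ else 0) (by
            convert hy using 2
            ext k l
            simp [ε])
        have h1 := hmem M Q
        rw [MvPolynomial.eval_rename] at h1
        have h2 : (fun p : Fin (N + 1) × Fin (N + 1) => (M * Q) p.1 p.2) ∘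
            (Subtype.val : HookIndex e → _) = y := by
          ext p
          simp only [Function.comp_apply]
          rw [hMQ _ _ p.2, of_apply, dif_pos p.2]
        rw [h2] at h1
        rw [h1, zero_mul]
    exact (mul_eq_zero.mp hprod).resolve_right hP0
  have halg : Algebra.IsAlgebraic (Algebra.adjoin K (Set.range x))
      (MvPolynomial (Fin (N + 1) × Fin (N + 1)) K ⧸ I) := by
    set S := Algebra.adjoin K (Set.range x)
    have hgen : ∀ i j, IsAlgebraic S (Ideal.Quotient.mkₐ K I (MvPolynomial.X (i, j))) := by
      intro i j
      by_cases hij : (e i).isLeft ∨ (e j).isLeft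
      · exact isAlgebraic_algebraMap (⟨x ⟨(i, j), hij⟩, Algebra.subset_adjoin ⟨_, rfl⟩⟩ : S)
      · let Z : Matrix (Fin (N + 1)) (Fin (N + 1)) S := Matrix.of fun i j =>
          if hij : (e i).isLeft ∨ (e j).isLeft then
            ⟨x ⟨(i, j), hij⟩, Algebra.subset_adjoin ⟨_, rfl⟩⟩ else 0
        have hZ : ∀ i j, (e i).isLeft ∨ (e j).isLeft → algebraMap S _ (Z i j) =
            Ideal.Quotient.mkₐ K I (genericMat K _ i j) := by
          intro i j hij
          simp only [Z, of_apply]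
          rw [dif_pos hij]
          rfl
        set G := (genericMat K (Fin (N + 1))).map (Ideal.Quotient.mkₐ K I)
        have hdet : algebraMap S _ (Z.submatrix ε ε).det = (G.submatrix ε ε).det := by
          rw [RingHom.map_det]
          congr 1
          ext k l
          exact hZ _ _ (Or.inl (hεl k))
        have hbm : borderedMinor G ε i j = 0 := by
          refine (map_borderedMinor (Ideal.Quotient.mk I) _ ε i j).symm.trans ?_
          exact Ideal.Quotient.eq_zero_iff_mem.mpr (borderedMinor_genericMat_mem hr hρ ε i j)
        have hc : algebraMap S _ ((Z.submatrix id ε * (Z.submatrix ε ε).adjugate *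
            Z.submatrix ε id) i j) =
            (G.submatrix id ε * (G.submatrix ε ε).adjugate * G.submatrix ε id) i j := by
          have h1 : (Z.submatrix id ε).map (algebraMap S _) = G.submatrix id ε := by
            ext k l
            exact hZ _ _ (Or.inr (hεl l))
          have h2 : (Z.submatrix ε id).map (algebraMap S _) = G.submatrix ε id := by
            ext k l
            exact hZ _ _ (Or.inl (hεl k))
          have h3 : (Z.submatrix ε ε).adjugate.map (algebraMap S _) =
              (G.submatrix ε ε).adjugate := by
            rw [← RingHom.mapMatrix_apply, RingHom.map_adjugate]
            congr 1
            ext k l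
            exact hZ _ _ (Or.inl (hεl k))
          rw [← h1, ← h2, ← h3, ← Matrix.map_mul, ← Matrix.map_mul]
          rfl
        -- The corner minor is not in the ideal, since some matrix of rank at most `r` has an
        -- identity corner; so the linear equation below is nontrivial.
        have hd0 : (Z.submatrix ε ε).det ≠ 0 := by
          intro h0
          rw [h0, map_zero] at hdet
          have h1 : ((genericMat K (Fin (N + 1))).submatrix ε ε).det ∈ I := by
            rw [← Ideal.Quotient.eq_zero_iff_mem, hdet, RingHom.map_det]
            rfl
          rw [mem_idealOf_iff hr hρ] at h1
          obtain ⟨M, Q, hMQ⟩ := exists_mul_eq_on_hook e (1 : Matrix _ _ K) (by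
            change ((1 : Matrix _ _ K).submatrix ε ε).det ≠ 0
            rw [submatrix_one ε (e.symm.injective.comp Sum.inl_injective), det_one]
            exact one_ne_zero)
          have h2 := h1 M Q
          rw [RingHom.map_det] at h2
          have h3 : (MvPolynomial.eval fun p => (M * Q) p.1 p.2).mapMatrix
              ((genericMat K (Fin (N + 1))).submatrix ε ε) = 1 := by
            ext k l
            simp only [genericMat, RingHom.mapMatrix_apply, map_apply, submatrix_apply, of_apply,
              MvPolynomial.eval_X]
            rw [hMQ _ _ (Or.inl (hεl k))]
            exact congrFun (congrFun (submatrix_one ε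
              (e.symm.injective.comp Sum.inl_injective)) k) l
          rw [h3, det_one] at h2
          exact one_ne_zero h2
        -- The vanishing bordered minor, read as a linear equation for the entry `(i, j)` with
        -- coefficients in the hook algebra.
        refine ⟨Polynomial.C (Z.submatrix ε ε).det * Polynomial.X - Polynomial.C
          ((Z.submatrix id ε * (Z.submatrix ε ε).adjugate * Z.submatrix ε id) i j), ?_, ?_⟩
        · intro h0
          have := congrArg (Polynomial.coeff · 1) h0
          simp at this
          exact hd0 this
        · rw [map_sub, map_mul, Polynomial.aeval_C, Polynomial.aeval_C, Polynomial.aeval_X, hdet, hc,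
            mul_comm]
          exact hbm
    constructor
    intro a
    obtain ⟨f, rfl⟩ := Ideal.Quotient.mk_surjective a
    induction f using MvPolynomial.induction_on with
    | C c =>
      exact isAlgebraic_algebraMap (algebraMap K S c)
    | add p q hp hq =>
      rw [map_add]
      exact hp.add hq
    | mul_X p i hp =>
      rw [map_mul]
      exact hp.mul (hgen i.1 i.2)
  have hb := hind.isTranscendenceBasis_iff_isAlgebraic.mpr halg
  have := hb.lift_cardinalMk_eq_trdeg
  rw [Cardinal.mk_fintype, Cardinal.lift_natCast] at this
  simpa using this.symm

theorem exists_block_form {x : MatProj K N} (hx : (toMat x).rank = r) :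
    ∃ (V U : Matrix (Fin (N + 1)) (Fin (N + 1)) K) (e : Fin (N + 1) ≃ Fin r ⊕ Fin (N + 1 - r)),
      IsUnit V.det ∧ IsUnit U.det ∧ V * toMat x * U = (fromBlocks 1 0 0 0).submatrix e e := by
  subst hx
  obtain ⟨V, U, e, hV, hU, h⟩ := (toMat x).exists_rank_normal_form
  rw [isUnit_iff_isUnit_det] at hV hU
  exact ⟨V, U, e.trans (Equiv.sumCongr (Equiv.refl _) (finCongr (by simp))), hV, hU, by
    rw [h]; ext i j; rcases hi : e i with a | a <;> rcases hj : e j with b | b <;> simp [hi, hj]⟩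

theorem mem_smoothLocus_of_rank_eq [Infinite K] (hr : 1 ≤ r) {x : MatProj K N}
    (hx : (toMat x).rank = r) : x ∈ smoothLocus (detVar K N r) := by
  obtain ⟨V, U, e, hV, hU, h⟩ := exists_block_form hx
  refine ⟨hx.le, ?_⟩
  rw [finrank_tangentSpace_detVar hr (Fintype.card_fin r) e hV hU h,
    trdeg_coordinateRing_detVar hr (Fintype.card_fin r) e]

/-- The tangent hyperplanes of the determinantal variety. -/
theorem isTangentAt_detVar_iff [Infinite K] (hr : 1 ≤ r) {x H : MatProj K N} :
    IsTangentAt (detVar K N r) x H ↔ (toMat x).rank = r ∧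
      (toMat x)ᵀ * toMat H = 0 ∧ toMat H * (toMat x)ᵀ = 0 := by
  have hrank : IsTangentAt (detVar K N r) x H → (toMat x).rank = r := by
    rintro ⟨hx, hH⟩
    refine le_antisymm hx.1 ?_
    by_contra! hlt
    -- No hyperplane contains the whole space; hence the smoothness of points of rank less than `r`
    -- need not be decided.
    rw [tangentSpace_eq_top hr hlt] at hH
    refine H.rep_nonzero (funext fun p => ?_)
    simpa [Pi.single_apply] using hH (Pi.single p 1) trivial
  suffices hx : (toMat x).rank = r → (IsTangentAt (detVar K N r) x H ↔
      (toMat x)ᵀ * toMat H = 0 ∧ toMat H * (toMat x)ᵀ = 0) from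
    ⟨fun h => ⟨hrank h, (hx (hrank h)).mp h⟩, fun h => (hx h.1).mpr h.2⟩
  intro hx
  obtain ⟨V, U, e, hV, hU, h⟩ := exists_block_form hx
  have hmem := fun w => mem_tangentSpace_detVar_iff hr (Fintype.card_fin r) e hV hU h (w := w)
  have htr : ∀ w : Fin (N + 1) × Fin (N + 1) → K, ∑ p, H.rep p * w p =
      trace ((toMat H)ᵀ * Matrix.of fun i j => w (i, j)) := by
    intro w
    rw [Fintype.sum_prod_type, Finset.sum_comm]
    rfl
  rw [IsTangentAt, and_iff_right (mem_smoothLocus_of_rank_eq hr hx)]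
  simp only [htr]
  constructor
  · intro hH
    -- The tangent space contains all `Y * A` and all `A * Y`, and the trace pairing is
    -- nondegenerate.
    have h1 : ∀ Y : Matrix (Fin (N + 1)) (Fin (N + 1)) K,
        trace ((toMat H)ᵀ * (Y * toMat x)) = 0 := by
      intro Y
      refine hH (fun p => (Y * toMat x) p.1 p.2) ((hmem _).mpr fun a b => ?_)
      change (V * (Y * toMat x) * U) _ _ = 0
      have : V * (Y * toMat x) * U = (V * Y * V⁻¹) * (V * toMat x * U) := by
        simp only [Matrix.mul_assoc]
        rw [nonsing_inv_mul_cancel_left V _ hV]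
      rw [this, h, mul_apply]
      refine Finset.sum_eq_zero fun k _ => ?_
      rcases hk : e k with k' | k' <;> simp [hk]
    have h2 : ∀ Y : Matrix (Fin (N + 1)) (Fin (N + 1)) K,
        trace ((toMat H)ᵀ * (toMat x * Y)) = 0 := by
      intro Y
      refine hH (fun p => (toMat x * Y) p.1 p.2) ((hmem _).mpr fun a b => ?_)
      change (V * (toMat x * Y) * U) _ _ = 0
      have : V * (toMat x * Y) * U = (V * toMat x * U) * (U⁻¹ * Y * U) := by
        simp only [Matrix.mul_assoc]
        rw [mul_nonsing_inv_cancel_left U _ hU]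
      rw [this, h, mul_apply]
      refine Finset.sum_eq_zero fun k _ => ?_
      rcases hk : e k with k' | k' <;> simp [hk]
    constructor
    · have : (toMat H)ᵀ * toMat x = 0 := by
        refine Matrix.ext_iff_trace_mul_right.mpr fun Y => ?_
        rw [Matrix.mul_assoc, h2, Matrix.zero_mul, trace_zero]
      rw [← transpose_transpose (toMat H), ← transpose_mul, this, transpose_zero]
    · have : toMat x * (toMat H)ᵀ = 0 := by
        refine Matrix.ext_iff_trace_mul_right.mpr fun Y => ?_
        rw [Matrix.mul_assoc, trace_mul_comm, Matrix.mul_assoc, h1, Matrix.zero_mul, trace_zero]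
      rw [← transpose_transpose (toMat H), ← transpose_mul, this, transpose_zero]
  · rintro ⟨h1, h2⟩ w hw
    rw [hmem] at hw
    set W : Matrix (Fin (N + 1)) (Fin (N + 1)) K := Matrix.of fun i j => w (i, j)
    have h1' : (toMat H)ᵀ * toMat x = 0 := by
      rw [← transpose_transpose (toMat x), ← transpose_mul, h1, transpose_zero]
    have h2' : toMat x * (toMat H)ᵀ = 0 := by
      rw [← transpose_transpose (toMat x), ← transpose_mul, h2, transpose_zero]
    -- In block coordinates `H'` lives in the lower right block, exactly where `V * W * U` vanishes
    -- for tangent `w`.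
    have ht : trace ((toMat H)ᵀ * W) =
        trace ((U⁻¹ * (toMat H)ᵀ * V⁻¹) * (V * W * U)) := by
      simp only [Matrix.mul_assoc]
      rw [nonsing_inv_mul_cancel_left V _ hV, trace_mul_comm U⁻¹, Matrix.mul_assoc, Matrix.mul_assoc,
        mul_nonsing_inv U hU, Matrix.mul_one]
    set H' := U⁻¹ * (toMat H)ᵀ * V⁻¹
    have a1 : H' * (fromBlocks 1 0 0 0).submatrix e e = 0 := by
      rw [← h]
      simp only [H', Matrix.mul_assoc]
      rw [nonsing_inv_mul_cancel_left V _ hV, ← Matrix.mul_assoc _ (toMat x), h1']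
      simp
    have a2 : (fromBlocks 1 0 0 0).submatrix e e * H' = 0 := by
      rw [← h]
      simp only [H', Matrix.mul_assoc]
      rw [mul_nonsing_inv_cancel_left U _ hU, ← Matrix.mul_assoc (toMat x), h2']
      simp
    have b1 : ∀ i k, H' i (e.symm (Sum.inl k)) = 0 := by
      intro i k
      have := congrFun (congrFun a1 i) (e.symm (Sum.inl k))
      rw [mul_apply, ← e.symm.sum_comp] at this
      simpa [one_apply] using this
    have b2 : ∀ j k, H' (e.symm (Sum.inl k)) j = 0 := by
      intro j k
      have := congrFun (congrFun a2 (e.symm (Sum.inl k))) j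
      rw [mul_apply, ← e.symm.sum_comp] at this
      simpa [one_apply] using this
    rw [ht, trace, ← e.symm.sum_comp]
    refine Finset.sum_eq_zero fun i _ => ?_
    rw [diag_apply, mul_apply, ← e.symm.sum_comp]
    refine Finset.sum_eq_zero fun j _ => ?_
    rcases i with i | i
    · rw [b2, zero_mul]
    · rcases j with j | j
      · rw [b1, zero_mul]
      · rw [hw, mul_zero]

end Smooth

/-! ### Homogeneous equations and closures. -/

section Closures

variable {K : Type*} [Field K] {ι κ : Type*}

theorem eval_smul_of_isHomogeneous {f : MvPolynomial ι K} {d : ℕ} (hf : f.IsHomogeneous d) (c : K)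
    (v : ι → K) : MvPolynomial.eval (c • v) f = c ^ d * MvPolynomial.eval v f := by
  rw [MvPolynomial.eval_eq, MvPolynomial.eval_eq, Finset.mul_sum]
  refine Finset.sum_congr rfl fun u hu => ?_
  have hd := hf.degree_eq_sum_deg_support hu
  simp only [Pi.smul_apply, smul_eq_mul, mul_pow, Finset.prod_mul_distrib]
  rw [Finset.prod_pow_eq_pow_sum, hd]
  ring

theorem eval_rep_mk_eq_zero_iff {f : MvPolynomial ι K} {d : ℕ} (hf : f.IsHomogeneous d)
    {v : ι → K} (hv : v ≠ 0) :
    MvPolynomial.eval (Projectivization.mk K v hv).rep f = 0 ↔ MvPolynomial.eval v f = 0 := by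
  obtain ⟨a, ha⟩ := Projectivization.exists_smul_eq_mk_rep K v hv
  rw [← ha, Units.smul_def, eval_smul_of_isHomogeneous hf, mul_eq_zero,
    or_iff_right (pow_ne_zero _ a.ne_zero)]

theorem isBihomogeneous_rename_inr {f : MvPolynomial κ K} {d : ℕ} (hf : f.IsHomogeneous d) :
    IsBihomogeneous (MvPolynomial.rename (Sum.inr : κ → ι ⊕ κ) f) 0 d := by
  intro u hu
  obtain ⟨u, rfl, hu'⟩ := MvPolynomial.coeff_rename_ne_zero _ _ _ hu
  have h1 := hf hu'
  rw [Finsupp.weight_apply] at h1 ⊢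
  rw [Finsupp.sum_mapDomain_index (by simp) (by simp [add_mul]), ← h1]
  simp [Finsupp.sum, Prod.ext_iff, Prod.fst_sum, Prod.snd_sum]

/-- Equations in the second factor pass to the closure in a product of projective spaces. -/
theorem eval_snd_eq_zero_of_mem_biprojClosure {S : Set (ℙ K (ι → K) × ℙ K (κ → K))}
    {p : ℙ K (ι → K) × ℙ K (κ → K)} (hp : p ∈ biprojClosure S) {f : MvPolynomial κ K} {d : ℕ}
    (hf : f.IsHomogeneous d) (h : ∀ q ∈ S, MvPolynomial.eval q.2.rep f = 0) :
    MvPolynomial.eval p.2.rep f = 0 := by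
  have := hp (MvPolynomial.rename Sum.inr f) 0 d (isBihomogeneous_rename_inr hf) fun q hq => by
    rw [MvPolynomial.eval_rename, Sum.elim_comp_inr]
    exact h q hq
  rwa [MvPolynomial.eval_rename, Sum.elim_comp_inr] at this

theorem subset_biprojClosure (S : Set (ℙ K (ι → K) × ℙ K (κ → K))) : S ⊆ biprojClosure S :=
  fun p hp _ _ _ _ h => h p hp

theorem biprojClosure_empty : biprojClosure (∅ : Set (ℙ K (ι → K) × ℙ K (κ → K))) = ∅ := by
  refine Set.eq_empty_of_forall_notMem fun p hp => ?_
  have := hp 1 0 0 (MvPolynomial.isWeightedHomogeneous_one _ _) (by simp)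
  rw [map_one] at this
  exact one_ne_zero this

end Closures

/-! ### The supported matrices as closure and as dual variety. -/

section Main

variable {K : Type*} [Field K] {ρ : Type} [Fintype ρ] [DecidableEq ρ] {N r s : ℕ}

/-- The points of the projective space of matrices whose row and column spaces lie in a common
`s`-dimensional subspace. -/
def supportedSet (K : Type*) [Field K] (N s : ℕ) : Set (MatProj K N) :=
  {B | IsSupported (Fin s) (toMat B)}

theorem IsSupported.smul {m τ : Type*} [Fintype m] [DecidableEq m] [Fintype τ] [DecidableEq τ]
    {B : Matrix m m K} (h : IsSupported τ B) (c : K) : IsSupported τ (c • B) := by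
  obtain ⟨L, L', S, hL, rfl⟩ := h
  exact ⟨L, L', c • S, hL, by rw [Matrix.mul_smul, Matrix.smul_mul]⟩

theorem isHomogeneous_det {σ κ : Type*} [Fintype κ] [DecidableEq κ]
    {A : Matrix κ κ (MvPolynomial σ K)} (hA : ∀ i j, (A i j).IsHomogeneous 1) :
    A.det.IsHomogeneous (Fintype.card κ) := by
  rw [det_apply']
  refine MvPolynomial.IsHomogeneous.sum _ _ _ fun π _ => ?_
  have h1 : (∏ i, A (π i) i).IsHomogeneous (Fintype.card κ) := by
    have := MvPolynomial.IsHomogeneous.prod Finset.univ (fun i => A (π i) i) (fun _ => 1)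
      fun i _ => hA _ _
    simpa using this
  have h2 := h1.C_mul ((Equiv.Perm.sign π : ℤ) : K)
  simpa using h2

/-- The equations of `supportedSet`. -/
noncomputable def supportEquation (P : Matrix (Option (Fin s)) (Fin (N + 1) ⊕ Fin (N + 1)) K)
    (Q : Matrix (Fin (N + 1)) (Option (Fin s)) K) :
    MvPolynomial (Fin (N + 1) × Fin (N + 1)) K :=
  ((P.map MvPolynomial.C : Matrix _ _ (MvPolynomial (Fin (N + 1) × Fin (N + 1)) K)) * fromRows
    (genericMat K (Fin (N + 1))) (genericMat K (Fin (N + 1)))ᵀ *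
    (Q.map MvPolynomial.C : Matrix _ _ (MvPolynomial (Fin (N + 1) × Fin (N + 1)) K))).det

theorem isHomogeneous_supportEquation
    (P : Matrix (Option (Fin s)) (Fin (N + 1) ⊕ Fin (N + 1)) K)
    (Q : Matrix (Fin (N + 1)) (Option (Fin s)) K) :
    (supportEquation P Q).IsHomogeneous (Fintype.card (Option (Fin s))) := by
  refine isHomogeneous_det fun i j => ?_
  rw [mul_apply]
  refine MvPolynomial.IsHomogeneous.sum _ _ _ fun k _ => ?_
  rw [mul_apply, Finset.sum_mul]
  refine MvPolynomial.IsHomogeneous.sum _ _ _ fun l _ => ?_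
  rw [mul_comm]
  refine MvPolynomial.IsHomogeneous.C_mul (MvPolynomial.IsHomogeneous.C_mul ?_ _) _
  rcases l with l | l
  · exact MvPolynomial.isHomogeneous_X _ _
  · exact MvPolynomial.isHomogeneous_X _ _

theorem eval_supportEquation
    (P : Matrix (Option (Fin s)) (Fin (N + 1) ⊕ Fin (N + 1)) K)
    (Q : Matrix (Fin (N + 1)) (Option (Fin s)) K) (B : MatProj K N) :
    MvPolynomial.eval B.rep (supportEquation P Q) =
      (P * fromRows (toMat B) (toMat B)ᵀ * Q).det := by
  rw [supportEquation, RingHom.map_det, RingHom.mapMatrix_apply, Matrix.map_mul, Matrix.map_mul]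
  congr 2
  · congr 1
    · ext; simp
    · ext i j
      rcases i with i | i <;> simp [genericMat, toMat]
  · ext; simp

theorem mem_supportedSet_iff (hr : r + s = N + 1) {B : MatProj K N} :
    B ∈ supportedSet K N s ↔ ∀ (P : Matrix (Option (Fin s)) (Fin (N + 1) ⊕ Fin (N + 1)) K)
      (Q : Matrix (Fin (N + 1)) (Option (Fin s)) K),
        MvPolynomial.eval B.rep (supportEquation P Q) = 0 := by
  simp only [eval_supportEquation]
  exact isSupported_iff_det (Fin r) (by simp [hr]) (toMat B)

/-- The set of matrices of rank `s` with symmetric `s`-th compound matrix is dense in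
`supportedSet`. -/
theorem projClosure_compound_isSymm [Infinite K] (hr : r + s = N + 1) :
    projClosure {B : MatProj K N | (toMat B).rank = s ∧ (compound s (toMat B)).IsSymm} =
      supportedSet K N s := by
  refine Set.Subset.antisymm (fun B hB => ?_) fun B hB f d hf h0 => ?_
  · rw [mem_supportedSet_iff hr]
    intro P Q
    refine hB _ _ (isHomogeneous_supportEquation P Q) fun A hA => ?_
    exact (mem_supportedSet_iff hr).mp (isSupported_of_compound_isSymm hA.1 hA.2) P Q
  · obtain ⟨L, L', S, hL, hLS⟩ := hB
    have hB0 : toMat B ≠ 0 := fun h => B.rep_nonzero (funext fun p => congrFun (congrFun h p.1) p.2)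
    have hs : s ≠ 0 := by
      rintro rfl
      refine hB0 ?_
      ext i j
      rw [hLS, mul_apply]
      simp
    -- The line is `L * (S + t • 1) * Lᵀ`. Its middle factor is singular only at the roots of the
    -- characteristic polynomial of `-S`, and elsewhere the matrix has rank exactly `s`.
    refine eval_eq_zero_of_eval_line f B.rep (fun p => (L * Lᵀ) p.1 p.2)
      (s := {t | (-S).charpoly.IsRoot t})
      (Polynomial.finite_setOfPred_isRoot (charpoly_monic _).ne_zero) fun t ht => ?_
    have hdet : (S + t • 1).det ≠ 0 := by
      intro h
      refine ht ?_
      rw [Set.mem_ofPred_eq, Polynomial.IsRoot, eval_charpoly, ← h]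
      congr 1
      rw [sub_neg_eq_add, add_comm, scalar_apply, smul_one_eq_diagonal]
    set A := L * (S + t • 1) * Lᵀ with hA
    have hv : (B.rep + t • fun p : Fin (N + 1) × Fin (N + 1) => (L * Lᵀ) p.1 p.2) =
        fun p => A p.1 p.2 := by
      have : A = toMat B + t • (L * Lᵀ) := by
        rw [hLS, hA, Matrix.mul_add, Matrix.add_mul, Matrix.mul_smul, Matrix.smul_mul,
          Matrix.mul_one]
      rw [this]
      rfl
    have hrank : A.rank = s := by
      refine le_antisymm ?_ ?_
      · exact ((rank_mul_le_right _ _).trans (rank_le_card_height _)).trans (by simp)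
      · have h1 : S + t • 1 = L' * A * L'ᵀ := by
          rw [hA, Matrix.mul_assoc, Matrix.mul_assoc _ Lᵀ, ← transpose_mul, hL, transpose_one,
            Matrix.mul_one, ← Matrix.mul_assoc, hL, Matrix.one_mul]
        have h2 := rank_of_det_ne_zero hdet
        rw [h1, Fintype.card_fin] at h2
        rw [← h2]
        exact (rank_mul_le_left _ _).trans (rank_mul_le_right _ _)
    have hA0 : (fun p : Fin (N + 1) × Fin (N + 1) => A p.1 p.2) ≠ 0 := by
      intro h
      have : A = 0 := by
        ext i j
        exact congrFun h (i, j)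
      rw [this, rank_zero] at hrank
      exact hs hrank.symm
    rw [hv, ← eval_rep_mk_eq_zero_iff hf hA0]
    obtain ⟨c, hc, hcA⟩ := exists_toMat_mk A hA0
    refine h0 _ ⟨?_, ?_⟩
    · rw [hcA, rank_smul_of_ne_zero hc, hrank]
    · rw [hcA]
      exact (IsSupported.smul ⟨L, L', _, hL, hA⟩ c).compound_isSymm

/-- The dual variety of the determinantal variety relative to the matrices `A` with `Aᵀ = ε A`,
provided that there is such a nonsingular matrix of size `r`. -/
theorem relDualVariety_eq_supportedSet [Infinite K] (hr : 1 ≤ r) (hrs : r + s = N + 1)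
    (hρ : Fintype.card ρ = r) {ε : K} (hε : ε ≠ 0) {S : Matrix ρ ρ K} (hS : S.det ≠ 0)
    (hSε : Sᵀ = ε • S) :
    relDualVariety (detVar K N r) {p | p ∈ detVar K N r ∧ (toMat p)ᵀ = ε • toMat p} =
      supportedSet K N s := by
  refine Set.Subset.antisymm ?_ fun B hB => ?_
  · rintro _ ⟨p, hp, rfl⟩
    rw [mem_supportedSet_iff hrs]
    intro P Q
    -- The equations of `supportedSet` involve only the second factor, so they pass from the open
    -- conormal set to its closure.
    refine eval_snd_eq_zero_of_mem_biprojClosure hp (isHomogeneous_supportEquation P Q)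
      fun q hq => (mem_supportedSet_iff hrs).mp ?_ P Q
    obtain ⟨⟨-, hq1⟩, hq2⟩ := hq
    rw [isTangentAt_detVar_iff hr, hq1, Matrix.smul_mul, Matrix.mul_smul] at hq2
    exact isSupported_of_annihilating hq2.1 (by simp [hrs]) hε hq1
      ((smul_eq_zero.mp hq2.2.1).resolve_left hε) ((smul_eq_zero.mp hq2.2.2).resolve_left hε)
  · obtain ⟨A, hA, hAt, h1, h2⟩ := IsSupported.exists_annihilating (ρ := ρ) (by simp [hrs, hρ])
      hB hS hSε
    have hA0 : (fun p : Fin (N + 1) × Fin (N + 1) => A p.1 p.2) ≠ 0 := by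
      intro h
      have : A = 0 := by
        ext i j
        exact congrFun h (i, j)
      rw [this, rank_zero] at hA
      omega
    obtain ⟨c, hc, hcA⟩ := exists_toMat_mk A hA0
    have hrank : (toMat (Projectivization.mk K _ hA0)).rank = r := by
      rw [hcA, rank_smul_of_ne_zero hc, hA, hρ]
    -- The pair already lies in the open conormal set; no limit is taken.
    refine ⟨(Projectivization.mk K _ hA0, B), subset_biprojClosure _ ⟨⟨hrank.le, ?_⟩, ?_⟩, rfl⟩
    · rw [hcA, transpose_smul, hAt, smul_comm]
    · rw [isTangentAt_detVar_iff hr, hcA, transpose_smul, hAt]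
      refine ⟨hcA ▸ hrank, ?_, ?_⟩
      · rw [Matrix.smul_mul, Matrix.smul_mul, h1, smul_zero, smul_zero]
      · rw [Matrix.mul_smul, Matrix.mul_smul, h2, smul_zero, smul_zero]

theorem relDualVariety_symDetVar [Infinite K] (hr : 1 ≤ r) (hrs : r + s = N + 1) :
    relDualVariety (detVar K N r) (symDetVar K N r) = supportedSet K N s := by
  rw [← relDualVariety_eq_supportedSet (ρ := Fin r) (S := 1) hr hrs (by simp) one_ne_zero (by simp)
    (by simp)]
  simp only [one_smul]
  rfl

theorem relDualVariety_skewDetVar_of_even [Infinite K] (hr : 1 ≤ r) (hrs : r + s = N + 1)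
    (he : Even r) : relDualVariety (detVar K N r) (skewDetVar K N r) = supportedSet K N s := by
  obtain ⟨k, rfl⟩ := he
  -- The standard symplectic matrix is the nonsingular skew matrix of size `r = k + k`.
  rw [← relDualVariety_eq_supportedSet (ρ := Fin k ⊕ Fin k) (S := J (Fin k) K) hr hrs (by simp)
    (neg_ne_zero.mpr one_ne_zero) (isUnit_det_J _ _).ne_zero (by rw [J_transpose, neg_one_smul])]
  simp only [neg_one_smul]
  rfl

/-- Tangency forces rank exactly `r`, while skew matrices have even rank, so the open conormal set
is empty. -/
theorem relDualVariety_skewDetVar_of_odd [CharZero K] (hr : 1 ≤ r) (ho : Odd r) :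
    relDualVariety (detVar K N r) (skewDetVar K N r) = ∅ := by
  have : relConormalOpen (detVar K N r) (skewDetVar K N r) = ∅ := by
    refine Set.eq_empty_of_forall_notMem ?_
    rintro q ⟨⟨-, hq1⟩, hq2⟩
    rw [isTangentAt_detVar_iff hr] at hq2
    have := even_rank_of_transpose_eq_neg hq1
    rw [hq2.1] at this
    exact Nat.not_even_iff_odd.mpr ho this
  rw [relDualVariety, relConormal, this, biprojClosure_empty, Set.image_empty]

end Main

end RelDual

theorem mainTheorem7 {K : Type*} [Field K] [IsAlgClosed K] [CharZero K]
    (N r : ℕ) (hr : 1 ≤ r) (hrN : r ≤ N + 1) :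
    RelDual.relDualVariety (RelDual.detVar K N r) (RelDual.symDetVar K N r) =
        RelDual.projClosure {B : RelDual.MatProj K N |
          (RelDual.toMat B).rank = N + 1 - r ∧
            (RelDual.compound (N + 1 - r) (RelDual.toMat B)).IsSymm} ∧
      (Even r →
        RelDual.relDualVariety (RelDual.detVar K N r) (RelDual.skewDetVar K N r) =
          RelDual.relDualVariety (RelDual.detVar K N r) (RelDual.symDetVar K N r)) ∧
      (Odd r →
        RelDual.relDualVariety (RelDual.detVar K N r) (RelDual.skewDetVar K N r) = ∅) := by
  have hrs : r + (N + 1 - r) = N + 1 := Nat.add_sub_cancel' hrN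
  refine ⟨?_, fun he => ?_, fun ho => RelDual.relDualVariety_skewDetVar_of_odd hr ho⟩
  · rw [RelDual.relDualVariety_symDetVar hr hrs, RelDual.projClosure_compound_isSymm hrs]
  · rw [RelDual.relDualVariety_symDetVar hr hrs,
      RelDual.relDualVariety_skewDetVar_of_even hr hrs he]
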